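/- Let $A$ be a finite set and $n\ge 3$. For $a\in A$ and $x,y\in A^n$ write $x\le_a y$ if $\{i: x_i=a\}\subseteq\{i: y_i=a\}$ and $x_i=y_i$ for every $i$ with $y_i\neq a$. A function $f:A^n\to A$ is called monotone if for all $a\in A$ and all $x\le_a y$, $f(x)=a$ implies $f(y)=a$; it is called symmetric if there is a transitive group $\Sigma\subseteq S_n$ such that $f(x_{\sigma(1)},\dots,x_{\sigma(n)})=f(x)$ for all $x\in A^n$ and $\sigma\in\Sigma$. Let $\Delta[A]$ be the simplex of probability measures on $A$, let $\gamma$ be the standard (uniform, i.e. normalized $(|A|-1)$-dimensional Lebesgue) probability measure on $\Delta[A]$, and for $\mu\in\Delta[A]$ let $P_\mu=\mu^{\otimes n}$ on $A^n$. Theorem. There is a constant $C=C(|A|)>0$, depending only on $|A|$, such that for every $n\ge 3$, every symmetric and monotone $f:A^n\to A$, every $a\in A$ and every $0<\varepsilon\le 1/2$, $$\gamma\bigl[\mu\in\Delta[A] : \varepsilon\le P_\mu[f=a]\le 1-\varepsilon\bigr]\ \le\ C\,\bigl(\log(1-\varepsilon)-\log\varepsilon\bigr)\,\frac{\log\log n}{\log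 n}.$$ -/

import Mathlib

open MeasureTheory ProbabilityTheory

namespace SharpThreshold

/-- The relation `x ≤_a y` on `A^n`: every coordinate equal to `a` in `x` equals `a` in `y`, and
`x` and `y` agree at every coordinate where `y` is not `a`. -/
def LeAt {A : Type*} {n : ℕ} (a : A) (x y : Fin n → A) : Prop :=
  {i | x i = a} ⊆ {i | y i = a} ∧ ∀ i, y i ≠ a → x i = y i

/-- `f : A^n → A` is monotone: for every `a`, if `x ≤_a y` and `f x = a` then `f y = a`. -/
def IsMonotone {A : Type*} {n : ℕ} (f : (Fin n → A) → A) : Prop :=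
  ∀ (a : A) (x y : Fin n → A), LeAt a x y → f x = a → f y = a

/-- `f : A^n → A` is symmetric: it is invariant under the coordinate permutations from some
transitive group of permutations of the `n` coordinates. -/
def IsSymmetric {A : Type*} {n : ℕ} (f : (Fin n → A) → A) : Prop :=
  ∃ G : Subgroup (Equiv.Perm (Fin n)), MulAction.IsPretransitive G (Fin n) ∧
    ∀ σ ∈ G, ∀ x : Fin n → A, f (fun i => x (σ i)) = f x

/-- The probability `P_μ[E]` of an event `E ⊆ A^n` under the product measure `μ^{⊗n}`, where a
probability measure `μ` on the finite set `A` is given by the masses of its atoms. -/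
noncomputable def productProb {A : Type*} [Fintype A] {n : ℕ} (μ : A → ℝ)
    (E : Set (Fin n → A)) : ℝ :=
  ∑ x : Fin n → A, E.indicator (fun x => ∏ i, μ (x i)) x

/-- The standard (uniform) probability measure `γ` on the simplex `Δ[A]`: the
`(|A| - 1)`-dimensional Hausdorff measure of the Euclidean space `ℝ^A`, conditioned on the simplex
`stdSimplex ℝ A`, that is, restricted to it and normalized to have total mass one. -/
noncomputable def simplexMeasure (A : Type*) [Fintype A] : Measure (A → ℝ) :=
  ProbabilityTheory.cond
    (Measure.map (WithLp.ofLp : EuclideanSpace ℝ A → (A → ℝ))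
      (Measure.hausdorffMeasure ((Fintype.card A : ℝ) - 1)))
    (stdSimplex ℝ A)

end SharpThreshold

namespace SharpThreshold

open Function Finset

/-! ### Product expectations and one-coordinate averages. -/

section Averages

/-! Fix `a` and join each point `ν` of the opposite face to the vertex `δ_a` by the segment `mix ν a
t`. Write `p(t)` for the probability of `f = a`. By monotonicity and Russo's formula
(`hasDerivAt_expect_mix`), `p'` is the sum over coordinates of the energies of the indicator of `f =
a`, and symmetry makes these energies equal to a common `D`, so `p' = nD`.

Two lower bounds on `nD` are available. Efron–Stein (`variance_le_energy`) gives `nD ≥ p(1 - p)`. If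
moreover every letter other than `a` has `ν`-mass at least `κ`, then `nD ≥ (κ log n / 16) p(1 - p)`
(`log_mul_variance_le_energy`): apply a logarithmic Sobolev inequality to each martingale difference
of the indicator. Small `D` makes these differences small in `L¹` and `L²`, hence of large entropy
relative to their second moment. It is essential that the constant `4 / κ` of `entropy_le_energy`
does not degenerate as `t` tends to `0` or `1`.

So `log (p / (1 - p))` grows at rate at least `max 1 (κ log n / 16)`, and each segment meets the set
to be measured in a length of order `(log (1 - ε) - log ε) / max 1 (κ log n / 16)` (`window_le`).
Integrating over segments (`volume_le_of_ray_windows`), the small values of `κ` near the boundary of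
the face produce a truncated integral of `1 / (κ log n)`. This is of order `log log n / log n`. -/

lemma prod_update_eq {A : Type*} {n : ℕ} (μ : A → ℝ) (x : Fin n → A) (i : Fin n) (c : A) :
    ∏ j, μ (update x i c j) = μ c * ∏ j ∈ univ.erase i, μ (x j) := by
  rw [← Finset.mul_prod_erase univ _ (mem_univ i)]
  simp only [update_self]
  congr 1
  exact Finset.prod_congr rfl fun j hj => by rw [update_of_ne (ne_of_mem_erase hj)]

variable {A : Type*} [Fintype A] {n : ℕ}

/-- The expectation of `g` under the product measure `μ^{⊗n}`. -/
noncomputable def expect (μ : A → ℝ) (g : (Fin n → A) → ℝ) : ℝ := ∑ x, (∏ i, μ (x i)) * g x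

/-- The average of `g` over the `i`-th coordinate. -/
noncomputable def avg (μ : A → ℝ) (i : Fin n) (g : (Fin n → A) → ℝ) : (Fin n → A) → ℝ :=
  fun x => ∑ c, μ c * g (update x i c)

/-- Successive averages of `g` over the coordinates of a list. -/
noncomputable def avgs (μ : A → ℝ) : List (Fin n) → ((Fin n → A) → ℝ) → ((Fin n → A) → ℝ)
  | [], g => g
  | i :: l, g => avgs μ l (avg μ i g)

/-- The martingale differences of `g` along a list of coordinates. -/
noncomputable def martingaleDiffs (μ : A → ℝ) :
    List (Fin n) → ((Fin n → A) → ℝ) → List ((Fin n → A) → ℝ)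
  | [], _ => []
  | i :: l, g => (g - avg μ i g) :: martingaleDiffs μ l (avg μ i g)

/-- The energy of `g` in the `i`-th coordinate, for jumps from `a` to a `ν`-distributed letter. -/
noncomputable def energy (ν : A → ℝ) (a : A) (i : Fin n) (g : (Fin n → A) → ℝ) :
    (Fin n → A) → ℝ :=
  fun x => ∑ b, ν b * (g (update x i b) - g (update x i a)) ^ 2

/-- Exchanging the letter `c` with the `i`-th letter of `x` is an involution on pairs `(x, c)`. -/
lemma sum_update_swap (i : Fin n) (K : (Fin n → A) → A → ℝ) :
    ∑ x, ∑ c, K x c = ∑ x, ∑ c, K (update x i c) (x i) := by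
  rw [← Fintype.sum_prod_type', ← Fintype.sum_prod_type']
  refine Finset.sum_nbij' (fun p => (update p.1 i p.2, p.1 i))
    (fun p => (update p.1 i p.2, p.1 i)) ?_ ?_ ?_ ?_ ?_ <;> simp

/-- Resampling the `i`-th coordinate according to the weights `τ`. -/
lemma expect_resample {μ : A → ℝ} (hμ : ∑ b, μ b = 1) (τ : A → ℝ) (i : Fin n)
    (g : (Fin n → A) → ℝ) :
    expect μ (fun x => ∑ c, τ c * g (update x i c)) =
      ∑ x, (∏ j ∈ univ.erase i, μ (x j)) * τ (x i) * g x := by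
  unfold expect
  simp_rw [Finset.mul_sum]
  rw [sum_update_swap i]
  refine Finset.sum_congr rfl fun x _ => ?_
  simp only [prod_update_eq, update_idem, update_eq_self]
  rw [← Finset.sum_mul, ← Finset.sum_mul, hμ]
  ring

lemma expect_avg {μ : A → ℝ} (hμ : ∑ b, μ b = 1) (i : Fin n) (g : (Fin n → A) → ℝ) :
    expect μ (avg μ i g) = expect μ g := by
  unfold avg
  rw [expect_resample hμ]
  refine Finset.sum_congr rfl fun x _ => ?_
  rw [← Finset.mul_prod_erase univ (fun j => μ (x j)) (mem_univ i)]
  ring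

lemma expect_mono {μ : A → ℝ} (h0 : ∀ b, 0 ≤ μ b) {g k : (Fin n → A) → ℝ} (h : ∀ x, g x ≤ k x) :
    expect μ g ≤ expect μ k :=
  Finset.sum_le_sum fun x _ =>
    mul_le_mul_of_nonneg_left (h x) (Finset.prod_nonneg fun _ _ => h0 _)

lemma expect_add (μ : A → ℝ) (g k : (Fin n → A) → ℝ) :
    expect μ (fun x => g x + k x) = expect μ g + expect μ k := by
  simp [expect, mul_add, Finset.sum_add_distrib]

lemma expect_sub (μ : A → ℝ) (g k : (Fin n → A) → ℝ) :
    expect μ (fun x => g x - k x) = expect μ g - expect μ k := by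
  simp [expect, mul_sub, Finset.sum_sub_distrib]

lemma expect_mul_left (μ : A → ℝ) (c : ℝ) (g : (Fin n → A) → ℝ) :
    expect μ (fun x => c * g x) = c * expect μ g := by
  simp only [expect, Finset.mul_sum]
  exact Finset.sum_congr rfl fun x _ => by ring

lemma expect_sum {ι : Type*} (μ : A → ℝ) (s : Finset ι) (g : ι → (Fin n → A) → ℝ) :
    expect μ (fun x => ∑ b ∈ s, g b x) = ∑ b ∈ s, expect μ (g b) := by
  simp only [expect, Finset.mul_sum]
  exact Finset.sum_comm

lemma expect_const {μ : A → ℝ} (hμ : ∑ b, μ b = 1) (c : ℝ) :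
    expect μ (fun _ : Fin n → A => c) = c := by
  have h : ∏ _i : Fin n, ∑ b, μ b = ∑ x : Fin n → A, ∏ i, μ (x i) := by
    rw [Finset.prod_univ_sum]; simp
  unfold expect
  rw [← Finset.sum_mul, ← h, hμ]; simp

lemma expect_nonneg {μ : A → ℝ} (h0 : ∀ b, 0 ≤ μ b) {g : (Fin n → A) → ℝ} (h : ∀ x, 0 ≤ g x) :
    0 ≤ expect μ g :=
  Finset.sum_nonneg fun x _ => mul_nonneg (Finset.prod_nonneg fun _ _ => h0 _) (h x)

lemma avg_update_self (μ : A → ℝ) (i : Fin n) (g : (Fin n → A) → ℝ) (x : Fin n → A) (c : A) :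
    avg μ i g (update x i c) = avg μ i g x := by
  simp [avg]

lemma avg_update_of_ne (μ : A → ℝ) {i k : Fin n} (hik : i ≠ k) (g : (Fin n → A) → ℝ)
    (x : Fin n → A) (c : A) :
    avg μ i g (update x k c) = avg μ i (fun y => g (update y k c)) x := by
  unfold avg
  exact Finset.sum_congr rfl fun d _ => by rw [update_comm hik.symm]

lemma avg_comm (μ : A → ℝ) (i k : Fin n) (g : (Fin n → A) → ℝ) :
    avg μ i (avg μ k g) = avg μ k (avg μ i g) := by
  rcases eq_or_ne i k with rfl | hik
  · rfl
  funext x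
  simp only [avg, Finset.mul_sum]
  rw [Finset.sum_comm]
  refine Finset.sum_congr rfl fun c _ => Finset.sum_congr rfl fun d _ => ?_
  rw [update_comm hik]; ring

lemma avg_sub (μ : A → ℝ) (i : Fin n) (g k : (Fin n → A) → ℝ) :
    avg μ i (g - k) = avg μ i g - avg μ i k := by
  funext x; simp [avg, mul_sub, Finset.sum_sub_distrib]

lemma avg_nonneg {μ : A → ℝ} (h0 : ∀ b, 0 ≤ μ b) (i : Fin n) {g : (Fin n → A) → ℝ}
    (h : ∀ x, 0 ≤ g x) (x : Fin n → A) : 0 ≤ avg μ i g x :=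
  Finset.sum_nonneg fun b _ => mul_nonneg (h0 b) (h _)

lemma abs_avg_le {μ : A → ℝ} (h0 : ∀ b, 0 ≤ μ b) (i : Fin n) (g : (Fin n → A) → ℝ)
    (x : Fin n → A) : |avg μ i g x| ≤ avg μ i (fun y => |g y|) x := by
  refine (Finset.abs_sum_le_sum_abs _ _).trans (Finset.sum_le_sum fun b _ => ?_)
  rw [abs_mul, abs_of_nonneg (h0 b)]

lemma sq_avg_le {μ : A → ℝ} (h0 : ∀ b, 0 ≤ μ b) (hμ : ∑ b, μ b = 1) (i : Fin n)
    (g : (Fin n → A) → ℝ) (x : Fin n → A) :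
    avg μ i g x ^ 2 ≤ avg μ i (fun y => g y ^ 2) x := by
  have h := Finset.sum_sq_le_sum_mul_sum_of_sq_le_mul univ (r := fun b => μ b * g (update x i b))
    (f := μ) (g := fun b => μ b * g (update x i b) ^ 2) (fun b _ => h0 b)
    (fun b _ => mul_nonneg (h0 b) (sq_nonneg _)) (fun b _ => le_of_eq (by ring))
  rw [hμ, one_mul] at h
  exact h

/-- Pythagoras for the projection `avg μ i`. -/
lemma expect_sq_sub_avg {μ : A → ℝ} (hμ : ∑ b, μ b = 1) (i : Fin n) (g : (Fin n → A) → ℝ) :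
    expect μ (fun x => (g - avg μ i g) x ^ 2) + expect μ (fun x => avg μ i g x ^ 2) =
      expect μ (fun x => g x ^ 2) := by
  have h : expect μ (fun x => g x * avg μ i g x) = expect μ (fun x => avg μ i g x ^ 2) := by
    -- Averaging `g * avg μ i g` over coordinate `i` pulls out the factor `avg μ i g`, which does
    -- not depend on that coordinate.
    rw [← expect_avg hμ i]
    congr 1
    funext x
    simp only [avg, update_idem]
    rw [sq, Finset.sum_mul]
    exact Finset.sum_congr rfl fun c _ => by ring
  have e : (fun x => g x ^ 2) = fun x => ((g - avg μ i g) x ^ 2 - avg μ i g x ^ 2)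
      + 2 * (g x * avg μ i g x) := by
    funext x; simp only [Pi.sub_apply]; ring
  rw [e, expect_add, expect_sub, expect_mul_left, h]; ring

end Averages

/-! ### One-coordinate logarithmic Sobolev inequality. -/

section Entropy

variable {A : Type*} [Fintype A]

lemma mul_log_mul_le {x s : ℝ} (hx : 0 ≤ x) (hs : 0 < s) :
    x * Real.log x - x * Real.log s ≤ x * (x / s - 1) := by
  rcases hx.eq_or_lt with rfl | hx
  · simp
  rw [← mul_sub, ← Real.log_div hx.ne' hs.ne']
  exact mul_le_mul_of_nonneg_left (Real.log_le_sub_one_of_pos (by positivity)) hx.le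

/-- From `log x ≤ x - 1`, the entropy of `u ^ 2` is at most its variance divided by its mean. The
variance is at most the second moment about any centre `c`, and leaving `c` free allows a centre
adapted to `t`. -/
lemma entropy_sq_le {μ : A → ℝ} (h0 : ∀ b, 0 ≤ μ b) (hμ : ∑ b, μ b = 1) (u : A → ℝ) (c : ℝ)
    (hS : 0 < ∑ b, μ b * u b ^ 2) :
    ∑ b, μ b * (u b ^ 2 * Real.log (u b ^ 2)) -
        (∑ b, μ b * u b ^ 2) * Real.log (∑ b, μ b * u b ^ 2) ≤
      (∑ b, μ b * (u b ^ 2 - c) ^ 2) / ∑ b, μ b * u b ^ 2 := by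
  set S := ∑ b, μ b * u b ^ 2 with hSdef
  have h1 : ∑ b, μ b * (u b ^ 2 * Real.log (u b ^ 2)) - S * Real.log S ≤
      (∑ b, μ b * (u b ^ 2) ^ 2) / S - S := by
    have : S * Real.log S = ∑ b, μ b * (u b ^ 2 * Real.log S) := by
      rw [hSdef, Finset.sum_mul]
      exact Finset.sum_congr rfl fun b _ => by ring
    rw [this, ← Finset.sum_sub_distrib]
    have h2 : (∑ b, μ b * (u b ^ 2) ^ 2) / S - S = ∑ b, μ b * (u b ^ 2 * (u b ^ 2 / S - 1)) := by
      conv_lhs => rw [Finset.sum_div, hSdef, ← hSdef, ← Finset.sum_sub_distrib]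
      exact Finset.sum_congr rfl fun b _ => by ring
    rw [h2]
    refine Finset.sum_le_sum fun b _ => ?_
    rw [← mul_sub]
    exact mul_le_mul_of_nonneg_left (mul_log_mul_le (sq_nonneg _) hS) (h0 b)
  have h3 : ∑ b, μ b * (u b ^ 2 - c) ^ 2 = ∑ b, μ b * (u b ^ 2) ^ 2 - 2 * c * S + c ^ 2 := by
    have : c ^ 2 = ∑ b, μ b * c ^ 2 := by rw [← Finset.sum_mul, hμ, one_mul]
    rw [this, hSdef, Finset.mul_sum, ← Finset.sum_sub_distrib, ← Finset.sum_add_distrib]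
    exact Finset.sum_congr rfl fun b _ => by ring
  refine h1.trans ?_
  rw [le_div_iff₀ hS, sub_mul, div_mul_cancel₀ _ hS.ne', h3]
  nlinarith [sq_nonneg (S - c)]

/-- The mixture `(1 - t) ν + t δ_a`. -/
noncomputable def mix [DecidableEq A] (ν : A → ℝ) (a : A) (t : ℝ) : A → ℝ :=
  fun b => (1 - t) * ν b + t * Pi.single (M := fun _ => ℝ) a 1 b

variable [DecidableEq A]

lemma mix_nonneg {A : Type*} [DecidableEq A] {ν : A → ℝ} (h0 : ∀ b, 0 ≤ ν b) (a : A) {t : ℝ}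
    (ht0 : 0 ≤ t) (ht1 : t ≤ 1) (b : A) : 0 ≤ mix ν a t b := by
  have : (0 : ℝ) ≤ Pi.single (M := fun _ => ℝ) a 1 b := by
    rw [Pi.single_apply]; split_ifs <;> norm_num
  have := h0 b
  have : 0 ≤ 1 - t := by linarith
  unfold mix; positivity

lemma sum_mix_mul (ν : A → ℝ) (a : A) (t : ℝ) (F : A → ℝ) :
    ∑ b, mix ν a t b * F b = (1 - t) * ∑ b, ν b * F b + t * F a := by
  simp only [mix, add_mul, Finset.sum_add_distrib, Finset.mul_sum]
  congr 1
  · exact Finset.sum_congr rfl fun b _ => by ring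
  · rw [Finset.sum_eq_single a] <;> simp +contextual

lemma sum_mix {ν : A → ℝ} (hν : ∑ b, ν b = 1) (a : A) (t : ℝ) : ∑ b, mix ν a t b = 1 := by
  have := sum_mix_mul ν a t (fun _ => 1)
  simp only [mul_one, hν] at this
  rw [this]; ring

/-- A logarithmic Sobolev inequality for `(1 - t) ν + t δ_a`, with a constant independent
of `t`. -/
lemma entropy_le_energy {ν : A → ℝ} {a : A} {κ t : ℝ} (h0 : ∀ b, 0 ≤ ν b)
    (hν : ∑ b, ν b = 1) (ha : ν a = 0) (hκ : 0 < κ) (hκν : ∀ b, b ≠ a → κ ≤ ν b)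
    (ht0 : 0 < t) (ht1 : t < 1) (u : A → ℝ) :
    ∑ b, mix ν a t b * (u b ^ 2 * Real.log (u b ^ 2)) -
        (∑ b, mix ν a t b * u b ^ 2) * Real.log (∑ b, mix ν a t b * u b ^ 2) ≤
      4 / κ * ∑ b, ν b * (u b - u a) ^ 2 := by
  have hmix0 := mix_nonneg h0 a ht0.le ht1.le
  have hE0 : 0 ≤ ∑ b, ν b * (u b - u a) ^ 2 :=
    Finset.sum_nonneg fun b _ => mul_nonneg (h0 b) (sq_nonneg _)
  have hSexp := sum_mix_mul ν a t (fun b => u b ^ 2)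
  set S := ∑ b, mix ν a t b * u b ^ 2 with hS
  have hQ0 : 0 ≤ ∑ b, ν b * u b ^ 2 :=
    Finset.sum_nonneg fun b _ => mul_nonneg (h0 b) (sq_nonneg _)
  have hS0 : 0 ≤ S := Finset.sum_nonneg fun b _ => mul_nonneg (hmix0 b) (sq_nonneg _)
  obtain ⟨b₀, hb₀⟩ : ∃ b, b ≠ a := by
    by_contra! hall
    have : ∑ b, ν b = 0 := Finset.sum_eq_zero fun b _ => by rw [hall b, ha]
    linarith
  have hκ1 : κ ≤ 1 := (hκν b₀ hb₀).trans
    ((Finset.single_le_sum (fun b _ => h0 b) (mem_univ b₀)).trans_eq hν)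
  have hub : ∀ b, b ≠ a → κ * u b ^ 2 ≤ ∑ b, ν b * u b ^ 2 := fun b hb =>
    (mul_le_mul_of_nonneg_right (hκν b hb) (sq_nonneg _)).trans
      (Finset.single_le_sum (f := fun b => ν b * u b ^ 2)
        (fun b _ => mul_nonneg (h0 b) (sq_nonneg _)) (mem_univ b))
  rcases hS0.eq_or_lt with hS0 | hS0
  · have hz : ∑ b, mix ν a t b * (u b ^ 2 * Real.log (u b ^ 2)) = 0 := by
      refine Finset.sum_eq_zero fun b _ => ?_
      have := (Finset.sum_eq_zero_iff_of_nonneg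
        (fun b _ => mul_nonneg (hmix0 b) (sq_nonneg (u b)))).1 (hS ▸ hS0.symm) b (mem_univ b)
      rw [← mul_assoc, this, zero_mul]
    rw [hz, ← hS0]
    simp only [zero_mul, sub_zero]
    positivity
  have key : ∀ c, ∑ b, mix ν a t b * (u b ^ 2 - c) ^ 2 ≤
      S * (4 / κ * ∑ b, ν b * (u b - u a) ^ 2) →
      ∑ b, mix ν a t b * (u b ^ 2 * Real.log (u b ^ 2)) - S * Real.log S ≤
        4 / κ * ∑ b, ν b * (u b - u a) ^ 2 := by
    intro c hc
    refine (entropy_sq_le hmix0 (sum_mix hν a t) u c hS0).trans ?_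
    rw [div_le_iff₀ hS0]
    linarith
  -- The centre follows the dominant part of the mixture. It is `u a ^ 2` when `δ_a` has weight at
  -- least `1 / 2`, which kills the term at `a`, and the square of the `ν`-mean of `u` otherwise. In
  -- both cases factor the difference of squares: the difference feeds the energy, and the squared
  -- sum, with its mixture weight, is absorbed by `S`.
  rcases le_or_gt (1 / 2) t with ht | ht
  · refine key (u a ^ 2) ?_
    rw [sum_mix_mul, sub_self, Finset.mul_sum, Finset.mul_sum, Finset.mul_sum]
    simp only [ne_eq, OfNat.ofNat_ne_zero, not_false_eq_true, zero_pow, mul_zero, add_zero]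
    refine Finset.sum_le_sum fun b _ => ?_
    rcases eq_or_ne b a with rfl | hb
    · simp
    have h1 : (1 - t) * (u b + u a) ^ 2 ≤ S * (4 / κ) := by
      rw [mul_div_assoc', le_div_iff₀ hκ, hSexp]
      have h2 := hub b hb
      have h3 : 0 ≤ (1 - t) * ((∑ b, ν b * u b ^ 2) - κ * u b ^ 2) :=
        mul_nonneg (by linarith) (by linarith)
      have h4 : (1 - t) * (u b + u a) ^ 2 * κ ≤
          (1 - t) * (2 * (u b ^ 2 + u a ^ 2)) * κ := by
        have : (u b + u a) ^ 2 ≤ 2 * (u b ^ 2 + u a ^ 2) := by nlinarith [sq_nonneg (u b - u a)]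
        gcongr
      have h5 : (1 - t) * u a ^ 2 * κ ≤ t * u a ^ 2 := by
        have : (1 - t) * κ ≤ t := by nlinarith
        nlinarith [sq_nonneg (u a)]
      nlinarith [sq_nonneg (u a), mul_nonneg (by linarith : 0 ≤ 1 - t) hQ0,
        mul_nonneg ht0.le (sq_nonneg (u a))]
    have := mul_le_mul_of_nonneg_right h1 (mul_nonneg (h0 b) (sq_nonneg (u b - u a)))
    calc _ = (1 - t) * (u b + u a) ^ 2 * (ν b * (u b - u a) ^ 2) := by ring
      _ ≤ _ := this
      _ = _ := by ring
  · set m := ∑ b, ν b * u b with hm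
    have hm2 : m ^ 2 ≤ ∑ b, ν b * u b ^ 2 := by
      have h := Finset.sum_sq_le_sum_mul_sum_of_sq_le_mul univ (r := fun b => ν b * u b)
        (f := ν) (g := fun b => ν b * u b ^ 2) (fun b _ => h0 b)
        (fun b _ => mul_nonneg (h0 b) (sq_nonneg _)) (fun b _ => le_of_eq (by ring))
      rwa [hν, one_mul] at h
    refine key (m ^ 2) ?_
    -- Bias–variance decomposition of the energy; `hA` uses the bias and `hB` the variance.
    have hsplit : ∑ b, ν b * (u b - u a) ^ 2 =
        ∑ b, ν b * (u b - m) ^ 2 + (u a - m) ^ 2 := by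
      have e1 : ∀ c, ∑ b, ν b * (u b - c) ^ 2 = ∑ b, ν b * u b ^ 2 - 2 * c * m + c ^ 2 := by
        intro c
        have : c ^ 2 = ∑ b, ν b * c ^ 2 := by rw [← Finset.sum_mul, hν, one_mul]
        rw [this, hm, Finset.mul_sum, ← Finset.sum_sub_distrib, ← Finset.sum_add_distrib]
        exact Finset.sum_congr rfl fun b _ => by ring
      rw [e1, e1]; ring
    have hA : t * (u a ^ 2 - m ^ 2) ^ 2 ≤ S * (4 / κ) * (u a - m) ^ 2 := by
      have h1 : t * (u a + m) ^ 2 ≤ 2 * S := by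
        have : (u a + m) ^ 2 ≤ 2 * (u a ^ 2 + m ^ 2) := by nlinarith [sq_nonneg (u a - m)]
        have h2 : t * (u a + m) ^ 2 ≤ t * (2 * (u a ^ 2 + m ^ 2)) := by gcongr
        have h3 : t * m ^ 2 ≤ (1 - t) * ∑ b, ν b * u b ^ 2 := by
          have : t * m ^ 2 ≤ (1 - t) * m ^ 2 := by nlinarith [sq_nonneg m]
          refine this.trans ?_
          gcongr
        rw [hSexp]; linarith
      have h2 : 2 * S ≤ S * (4 / κ) := by
        rw [mul_div_assoc', le_div_iff₀ hκ]; nlinarith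
      calc _ = t * (u a + m) ^ 2 * (u a - m) ^ 2 := by ring
        _ ≤ _ := mul_le_mul_of_nonneg_right (h1.trans h2) (sq_nonneg _)
    have hB : (1 - t) * ∑ b, ν b * (u b ^ 2 - m ^ 2) ^ 2 ≤
        S * (4 / κ) * ∑ b, ν b * (u b - m) ^ 2 := by
      rw [Finset.mul_sum, Finset.mul_sum]
      refine Finset.sum_le_sum fun b _ => ?_
      rcases eq_or_ne b a with rfl | hb
      · simp [ha]
      have h1 : (1 - t) * (u b + m) ^ 2 ≤ S * (4 / κ) := by
        rw [mul_div_assoc', le_div_iff₀ hκ, hSexp]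
        have h4 : (1 - t) * (u b + m) ^ 2 * κ ≤ (1 - t) * (2 * (u b ^ 2 + m ^ 2)) * κ := by
          have : (u b + m) ^ 2 ≤ 2 * (u b ^ 2 + m ^ 2) := by nlinarith [sq_nonneg (u b - m)]
          gcongr
        have h5 : 2 * (u b ^ 2 + m ^ 2) * κ ≤ 4 * ∑ b, ν b * u b ^ 2 := by
          have := hub b hb
          nlinarith [sq_nonneg m]
        have h6 : (1 - t) * (2 * (u b ^ 2 + m ^ 2) * κ) ≤
            (1 - t) * (4 * ∑ b, ν b * u b ^ 2) :=
          mul_le_mul_of_nonneg_left h5 (by linarith)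
        nlinarith [mul_nonneg ht0.le (sq_nonneg (u a))]
      have := mul_le_mul_of_nonneg_right h1 (mul_nonneg (h0 b) (sq_nonneg (u b - m)))
      calc _ = (1 - t) * (u b + m) ^ 2 * (ν b * (u b - m) ^ 2) := by ring
        _ ≤ _ := this
        _ = _ := by ring
    rw [sum_mix_mul, hsplit]
    linarith

end Entropy

/-! ### From one coordinate to the product space. -/

section Tensorization

variable {A : Type*} [Fintype A] {n : ℕ}

lemma energy_nonneg {ν : A → ℝ} (h0 : ∀ b, 0 ≤ ν b) (a : A) (i : Fin n)
    (g : (Fin n → A) → ℝ) (x : Fin n → A) : 0 ≤ energy ν a i g x :=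
  Finset.sum_nonneg fun b _ => mul_nonneg (h0 b) (sq_nonneg _)

lemma energy_abs_le {ν : A → ℝ} (h0 : ∀ b, 0 ≤ ν b) (a : A) (i : Fin n)
    (g : (Fin n → A) → ℝ) (x : Fin n → A) :
    energy ν a i (fun y => |g y|) x ≤ energy ν a i g x :=
  Finset.sum_le_sum fun b _ =>
    mul_le_mul_of_nonneg_left (sq_le_sq.2 (abs_abs_sub_abs_le _ _)) (h0 b)

/-- The reverse triangle inequality in `L²(μ)` for `√p` and `√q`, proved by Cauchy–Schwarz. -/
lemma sq_sqrt_sum_sub_sqrt_sum_le {μ : A → ℝ} (h0 : ∀ b, 0 ≤ μ b) {p q : A → ℝ}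
    (hp : ∀ b, 0 ≤ p b) (hq : ∀ b, 0 ≤ q b) :
    (√(∑ c, μ c * p c) - √(∑ c, μ c * q c)) ^ 2 ≤ ∑ c, μ c * (√(p c) - √(q c)) ^ 2 := by
  have h := Real.sum_sqrt_mul_sqrt_le univ (f := fun c => μ c * p c) (g := fun c => μ c * q c)
    (fun c => mul_nonneg (h0 c) (hp c)) (fun c => mul_nonneg (h0 c) (hq c))
  have h1 : ∑ c, √(μ c * p c) * √(μ c * q c) = ∑ c, μ c * (√(p c) * √(q c)) := by
    refine Finset.sum_congr rfl fun c _ => ?_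
    rw [Real.sqrt_mul (h0 c), Real.sqrt_mul (h0 c)]
    linear_combination (√(p c) * √(q c)) * Real.mul_self_sqrt (h0 c)
  have h2 : ∑ c, μ c * (√(p c) - √(q c)) ^ 2 =
      ∑ c, μ c * p c + ∑ c, μ c * q c - 2 * ∑ c, μ c * (√(p c) * √(q c)) := by
    rw [Finset.mul_sum, ← Finset.sum_add_distrib, ← Finset.sum_sub_distrib]
    refine Finset.sum_congr rfl fun c _ => ?_
    linear_combination μ c * Real.sq_sqrt (hp c) + μ c * Real.sq_sqrt (hq c)
  have h3 := Real.sq_sqrt (Finset.sum_nonneg fun c (_ : c ∈ univ) => mul_nonneg (h0 c) (hp c))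
  have h4 := Real.sq_sqrt (Finset.sum_nonneg fun c (_ : c ∈ univ) => mul_nonneg (h0 c) (hq c))
  rw [h1] at h
  rw [h2]
  nlinarith

/-- Keeps the tensorization induction closed: averaging out coordinate `i` does not increase the
mean energy of the square root in the remaining coordinates. -/
lemma energy_sqrt_avg_le {μ ν : A → ℝ} (hμ0 : ∀ b, 0 ≤ μ b) (hν0 : ∀ b, 0 ≤ ν b) (a : A)
    {i k : Fin n} (hik : i ≠ k) {u : (Fin n → A) → ℝ} (hu : ∀ x, 0 ≤ u x) (x : Fin n → A) :
    energy ν a k (fun y => √(avg μ i u y)) x ≤ avg μ i (energy ν a k (fun y => √(u y))) x := by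
  simp only [energy, avg_update_of_ne μ hik]
  have : avg μ i (energy ν a k (fun y => √(u y))) x =
      ∑ b, ν b * ∑ c, μ c * (√(u (update (update x i c) k b)) -
        √(u (update (update x i c) k a))) ^ 2 := by
    simp only [avg, energy, Finset.mul_sum]
    rw [Finset.sum_comm]
    exact Finset.sum_congr rfl fun b _ => Finset.sum_congr rfl fun c _ => by ring
  rw [this]
  exact Finset.sum_le_sum fun b _ => mul_le_mul_of_nonneg_left
    (sq_sqrt_sum_sub_sqrt_sum_le hμ0 (fun c => hu _) (fun c => hu _)) (hν0 b)

/-- Tensorization of a one-coordinate logarithmic Sobolev inequality. -/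
lemma expect_entropy_avgs_le {μ ν : A → ℝ} (hμ0 : ∀ b, 0 ≤ μ b) (hμ : ∑ b, μ b = 1)
    (hν0 : ∀ b, 0 ≤ ν b) (a : A) {C : ℝ} (hC : 0 ≤ C)
    (hsite : ∀ v : A → ℝ, ∑ b, μ b * (v b ^ 2 * Real.log (v b ^ 2)) -
        (∑ b, μ b * v b ^ 2) * Real.log (∑ b, μ b * v b ^ 2) ≤
      C * ∑ b, ν b * (v b - v a) ^ 2)
    (l : List (Fin n)) (hl : l.Nodup) (u : (Fin n → A) → ℝ) (hu : ∀ x, 0 ≤ u x) :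
    expect μ (fun x => u x * Real.log (u x)) -
        expect μ (fun x => avgs μ l u x * Real.log (avgs μ l u x)) ≤
      C * (l.map fun i => expect μ (energy ν a i (fun x => √(u x)))).sum := by
  induction l generalizing u with
  | nil => simp [avgs]
  | cons i l ih =>
    rw [List.nodup_cons] at hl
    have h1 := ih hl.2 (avg μ i u) (avg_nonneg hμ0 i hu)
    have h2 : (l.map fun k => expect μ (energy ν a k (fun x => √(avg μ i u x)))).sum ≤
        (l.map fun k => expect μ (energy ν a k (fun x => √(u x)))).sum := by
      refine List.sum_le_sum fun k hk => ?_
      have hik : i ≠ k := fun h => hl.1 (h ▸ hk)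
      refine (expect_mono hμ0 (energy_sqrt_avg_le hμ0 hν0 a hik hu)).trans_eq ?_
      exact expect_avg hμ i _
    have h3 : expect μ (fun x => u x * Real.log (u x)) -
        expect μ (fun x => avg μ i u x * Real.log (avg μ i u x)) ≤
        C * expect μ (energy ν a i (fun x => √(u x))) := by
      rw [← expect_avg hμ i (fun x => u x * Real.log (u x)), ← expect_sub, ← expect_mul_left]
      refine expect_mono hμ0 fun x => ?_
      have := hsite (fun b => √(u (update x i b)))
      simp only [Real.sq_sqrt (hu _)] at this
      exact this
    simp only [avgs, List.map_cons, List.sum_cons]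
    have h4 := mul_le_mul_of_nonneg_left h2 hC
    linarith

lemma eq_of_forall_update_eq {A : Type*} {n : ℕ} (g : (Fin n → A) → ℝ)
    (h : ∀ x i c, g (update x i c) = g x) (x y : Fin n → A) : g x = g y := by
  have : ∀ s : Finset (Fin n), g (s.piecewise y x) = g x := by
    intro s
    induction s using Finset.induction_on with
    | empty => simp
    | insert i s _ ih => rw [Finset.piecewise_insert, h, ih]
  rw [← this univ, Finset.piecewise_univ]

lemma avgs_update (μ : A → ℝ) (l : List (Fin n)) (g : (Fin n → A) → ℝ) (i : Fin n)
    (h : i ∈ l ∨ ∀ x c, g (update x i c) = g x) (x : Fin n → A) (c : A) :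
    avgs μ l g (update x i c) = avgs μ l g x := by
  induction l generalizing g with
  | nil => simpa [avgs] using h.resolve_left (by simp) x c
  | cons k l ih =>
    refine ih _ ?_
    rcases eq_or_ne k i with rfl | hki
    · exact Or.inr fun x c => avg_update_self μ k g x c
    · rcases h with h | h
      · exact Or.inl ((List.mem_cons.1 h).resolve_left hki.symm)
      · right
        intro x c
        rw [avg_update_of_ne μ hki]
        simp only [avg, h]

lemma expect_avgs {μ : A → ℝ} (hμ : ∑ b, μ b = 1) (l : List (Fin n)) (g : (Fin n → A) → ℝ) :
    expect μ (avgs μ l g) = expect μ g := by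
  induction l generalizing g with
  | nil => rfl
  | cons i l ih => rw [avgs, ih, expect_avg hμ]

lemma avgs_eq_expect {μ : A → ℝ} (hμ : ∑ b, μ b = 1) {l : List (Fin n)} (hl : ∀ i, i ∈ l)
    (g : (Fin n → A) → ℝ) : avgs μ l g = fun _ => expect μ g := by
  funext x
  have h : avgs μ l g = fun _ => avgs μ l g x := by
    funext y
    exact eq_of_forall_update_eq _ (fun x i c => avgs_update μ l g i (Or.inl (hl i)) x c) y x
  rw [← expect_avgs hμ l g]
  conv_rhs => rw [h]
  rw [expect_const hμ]

/-- The logarithmic Sobolev inequality on `A^n`. -/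
lemma expect_entropy_le {μ ν : A → ℝ} (hμ0 : ∀ b, 0 ≤ μ b) (hμ : ∑ b, μ b = 1)
    (hν0 : ∀ b, 0 ≤ ν b) (a : A) {C : ℝ} (hC : 0 ≤ C)
    (hsite : ∀ v : A → ℝ, ∑ b, μ b * (v b ^ 2 * Real.log (v b ^ 2)) -
        (∑ b, μ b * v b ^ 2) * Real.log (∑ b, μ b * v b ^ 2) ≤
      C * ∑ b, ν b * (v b - v a) ^ 2)
    (d : (Fin n → A) → ℝ) :
    expect μ (fun x => d x ^ 2 * Real.log (d x ^ 2)) -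
        expect μ (fun x => d x ^ 2) * Real.log (expect μ (fun x => d x ^ 2)) ≤
      C * ∑ i, expect μ (energy ν a i d) := by
  have h := expect_entropy_avgs_le hμ0 hμ hν0 a hC hsite (List.finRange n)
    (List.nodup_finRange n) (fun x => d x ^ 2) (fun x => sq_nonneg _)
  rw [avgs_eq_expect hμ (List.mem_finRange)] at h
  rw [expect_const hμ] at h
  -- With `u = d ^ 2` the square root is `|d|`, whose energy is at most that of `d`.
  simp only [Real.sqrt_sq_eq_abs] at h
  rw [← List.ofFn_eq_map, List.sum_ofFn] at h
  refine h.trans (mul_le_mul_of_nonneg_left (Finset.sum_le_sum fun i _ => ?_) hC)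
  exact expect_mono hμ0 (energy_abs_le hν0 a i d)

end Tensorization

/-! ### Martingale differences: orthogonality and contraction. -/

section Martingale

variable {A : Type*} [Fintype A] {n : ℕ}

lemma sum_expect_sq_martingaleDiffs {μ : A → ℝ} (hμ : ∑ b, μ b = 1) (l : List (Fin n))
    (g : (Fin n → A) → ℝ) :
    ((martingaleDiffs μ l g).map fun d => expect μ (fun x => d x ^ 2)).sum =
      expect μ (fun x => g x ^ 2) - expect μ (fun x => avgs μ l g x ^ 2) := by
  induction l generalizing g with
  | nil => simp [martingaleDiffs, avgs]
  | cons i l ih =>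
    simp only [martingaleDiffs, avgs, List.map_cons, List.sum_cons, ih]
    linarith [expect_sq_sub_avg hμ i g]

lemma expect_energy {μ ν : A → ℝ} (a : A) (i : Fin n) (g : (Fin n → A) → ℝ) :
    expect μ (energy ν a i g) =
      ∑ b, ν b * expect μ (fun x => (g (update x i b) - g (update x i a)) ^ 2) := by
  unfold energy
  rw [expect_sum]
  exact Finset.sum_congr rfl fun b _ => expect_mul_left _ _ _

/-- For `k ≠ i`, averaging over `k` commutes with differences in coordinate `i`, so this is
Pythagoras for each difference. For `k = i` the average has no energy. -/
lemma expect_energy_sub_avg {μ ν : A → ℝ} (hμ : ∑ b, μ b = 1) (a : A) (i k : Fin n)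
    (g : (Fin n → A) → ℝ) :
    expect μ (energy ν a i (g - avg μ k g)) + expect μ (energy ν a i (avg μ k g)) =
      expect μ (energy ν a i g) := by
  rcases eq_or_ne k i with rfl | hki
  · have h1 : energy ν a k (avg μ k g) = fun _ => 0 := by
      funext x; simp [energy, avg_update_self]
    have h2 : energy ν a k (g - avg μ k g) = energy ν a k g := by
      funext x; simp [energy, avg_update_self]
    rw [h1, h2, expect_const hμ, add_zero]
  · simp only [expect_energy, ← Finset.sum_add_distrib, ← mul_add]
    refine Finset.sum_congr rfl fun b _ => ?_
    congr 1
    rw [← expect_sq_sub_avg hμ k (fun x => g (update x i b) - g (update x i a))]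
    have e : ∀ x, avg μ k (fun x => g (update x i b) - g (update x i a)) x =
        avg μ k g (update x i b) - avg μ k g (update x i a) := by
      intro x
      rw [avg_update_of_ne μ hki, avg_update_of_ne μ hki]
      exact congrFun (avg_sub μ k (fun x => g (update x i b)) (fun x => g (update x i a))) x
    simp only [Pi.sub_apply, e]
    congr 2
    funext x
    ring

lemma sum_expect_energy_martingaleDiffs_le {μ ν : A → ℝ} (hμ0 : ∀ b, 0 ≤ μ b)
    (hμ : ∑ b, μ b = 1) (hν0 : ∀ b, 0 ≤ ν b) (a : A) (i : Fin n) (l : List (Fin n))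
    (g : (Fin n → A) → ℝ) :
    ((martingaleDiffs μ l g).map fun d => expect μ (energy ν a i d)).sum ≤
      expect μ (energy ν a i g) := by
  induction l generalizing g with
  | nil => simpa [martingaleDiffs] using expect_nonneg hμ0 (energy_nonneg hν0 a i g)
  | cons k l ih =>
    simp only [martingaleDiffs, List.map_cons, List.sum_cons]
    linarith [expect_energy_sub_avg (ν := ν) hμ a i k g, ih (avg μ k g)]

lemma length_martingaleDiffs (μ : A → ℝ) (l : List (Fin n)) (g : (Fin n → A) → ℝ) :
    (martingaleDiffs μ l g).length = l.length := by
  induction l generalizing g with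
  | nil => rfl
  | cons k l ih => simp [martingaleDiffs, ih]

/-- Since averages commute, the difference taken at coordinate `i` is an iterated average of `g -
avg μ i g`; a functional that averaging does not increase is therefore controlled by its value
there. -/
lemma martingaleDiffs_le_of_contraction {μ : A → ℝ} (Φ : ((Fin n → A) → ℝ) → ℝ)
    (hΦ : ∀ i g, Φ (avg μ i g) ≤ Φ g) {c : ℝ} (l : List (Fin n)) (g : (Fin n → A) → ℝ)
    (h : ∀ i, Φ (g - avg μ i g) ≤ c) : ∀ d ∈ martingaleDiffs μ l g, Φ d ≤ c := by
  induction l generalizing g with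
  | nil => simp [martingaleDiffs]
  | cons k l ih =>
    intro d hd
    rcases List.mem_cons.1 hd with rfl | hd
    · exact h k
    · refine ih (avg μ k g) (fun i => ?_) d hd
      rw [avg_comm, ← avg_sub]
      exact (hΦ k _).trans (h i)

lemma expect_abs_avg_le {μ : A → ℝ} (hμ0 : ∀ b, 0 ≤ μ b) (hμ : ∑ b, μ b = 1) (i : Fin n)
    (g : (Fin n → A) → ℝ) :
    expect μ (fun x => |avg μ i g x|) ≤ expect μ (fun x => |g x|) :=
  (expect_mono hμ0 (abs_avg_le hμ0 i g)).trans_eq (expect_avg hμ i _)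

lemma expect_sq_avg_le {μ : A → ℝ} (hμ0 : ∀ b, 0 ≤ μ b) (hμ : ∑ b, μ b = 1) (i : Fin n)
    (g : (Fin n → A) → ℝ) :
    expect μ (fun x => avg μ i g x ^ 2) ≤ expect μ (fun x => g x ^ 2) :=
  (expect_mono hμ0 (sq_avg_le hμ0 hμ i g)).trans_eq (expect_avg hμ i _)

end Martingale

/-! ### Logarithmic gain over the Efron–Stein inequality. -/

section Variance

variable {A : Type*} [Fintype A] {n : ℕ}

lemma sub_avg_eq {μ : A → ℝ} (hμ : ∑ b, μ b = 1) (a : A) (i : Fin n) (h : (Fin n → A) → ℝ) :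
    h - avg μ i h =
      (fun x => h x - h (update x i a)) - avg μ i (fun x => h x - h (update x i a)) := by
  funext x
  simp only [Pi.sub_apply, avg, update_idem, mul_sub, Finset.sum_sub_distrib,
    ← Finset.sum_mul, hμ, one_mul]
  ring

lemma sum_expect_sq_martingaleDiffs_bool {μ : A → ℝ} (hμ : ∑ b, μ b = 1)
    {h : (Fin n → A) → ℝ} (hbool : ∀ x, h x = 0 ∨ h x = 1) :
    ((martingaleDiffs μ (List.finRange n) h).map fun d => expect μ (fun x => d x ^ 2)).sum =
      expect μ h * (1 - expect μ h) := by
  rw [sum_expect_sq_martingaleDiffs hμ, avgs_eq_expect hμ List.mem_finRange, expect_const hμ]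
  have : (fun x => h x ^ 2) = h := by
    funext x; rcases hbool x with e | e <;> simp [e]
  rw [this]; ring

/-- Pointwise `log (θ / |d|) ≤ θ / |d| - 1`, multiplied by `2 d ^ 2`: a small `L¹` norm relative to
the second moment forces large entropy. -/
lemma two_mul_log_sub_le {μ : A → ℝ} (hμ0 : ∀ b, 0 ≤ μ b) {θ : ℝ} (hθ : 0 < θ)
    (d : (Fin n → A) → ℝ) :
    2 * Real.log θ * expect μ (fun x => d x ^ 2) -
        expect μ (fun x => d x ^ 2 * Real.log (d x ^ 2)) ≤
      2 * (θ * expect μ (fun x => |d x|) - expect μ (fun x => d x ^ 2)) := by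
  rw [← expect_mul_left, ← expect_sub, ← expect_mul_left, ← expect_sub, ← expect_mul_left]
  refine expect_mono hμ0 fun x => ?_
  rcases eq_or_ne (d x) 0 with e | e
  · simp [e]
  have hp : 0 < |d x| := abs_pos.2 e
  have h1 : Real.log (d x ^ 2) = 2 * Real.log |d x| := by
    rw [← sq_abs, Real.log_pow]; norm_num
  have h2 := Real.log_le_sub_one_of_pos (div_pos hθ hp)
  rw [Real.log_div hθ.ne' hp.ne'] at h2
  have h3 : |d x| ^ 2 * (Real.log θ - Real.log |d x|) ≤ |d x| ^ 2 * (θ / |d x| - 1) := by gcongr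
  have h4 : |d x| ^ 2 * (θ / |d x| - 1) = θ * |d x| - |d x| ^ 2 := by field_simp
  rw [h1, ← sq_abs]
  linarith

variable [DecidableEq A]

/-- The `i`-th letter is drawn from `δ_a` with weight `t`, contributing nothing, and from `ν` with
weight `1 - t`. -/
lemma expect_sq_sub_update (ν : A → ℝ) {a : A} (hν : ∑ b, ν b = 1) (t : ℝ) (i : Fin n)
    (h : (Fin n → A) → ℝ) :
    expect (mix ν a t) (fun x => (h x - h (update x i a)) ^ 2) =
      (1 - t) * expect (mix ν a t) (energy ν a i h) := by
  rw [← expect_avg (sum_mix hν a t) i, ← expect_mul_left]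
  congr 1
  funext x
  simp only [avg, update_idem, energy]
  rw [sum_mix_mul ν a t (fun c => (h (update x i c) - h (update x i a)) ^ 2)]
  simp

lemma expect_sq_sub_avg_le_energy {ν : A → ℝ} {a : A} {t : ℝ} (h0 : ∀ b, 0 ≤ ν b)
    (hν : ∑ b, ν b = 1) (ht0 : 0 ≤ t) (ht1 : t ≤ 1) (i : Fin n) (h : (Fin n → A) → ℝ) :
    expect (mix ν a t) (fun x => (h - avg (mix ν a t) i h) x ^ 2) ≤
      expect (mix ν a t) (energy ν a i h) := by
  have hμ0 := mix_nonneg h0 a ht0 ht1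
  have hμ := sum_mix hν a t
  have hE := expect_nonneg hμ0 (energy_nonneg h0 a i h)
  have h1 := expect_sq_sub_avg hμ i (fun x => h x - h (update x i a))
  rw [← sub_avg_eq hμ, expect_sq_sub_update ν hν] at h1
  have h2 := expect_nonneg hμ0
    (fun x => sq_nonneg (avg (mix ν a t) i (fun x => h x - h (update x i a)) x))
  nlinarith

lemma expect_abs_sub_avg_le_energy {ν : A → ℝ} {a : A} {t : ℝ} (h0 : ∀ b, 0 ≤ ν b)
    (hν : ∑ b, ν b = 1) (ht0 : 0 ≤ t) (ht1 : t ≤ 1) (i : Fin n) {h : (Fin n → A) → ℝ}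
    (hbool : ∀ x, h x = 0 ∨ h x = 1) :
    expect (mix ν a t) (fun x => |(h - avg (mix ν a t) i h) x|) ≤
      2 * expect (mix ν a t) (energy ν a i h) := by
  have hμ0 := mix_nonneg h0 a ht0 ht1
  have hμ := sum_mix hν a t
  have hE := expect_nonneg hμ0 (energy_nonneg h0 a i h)
  have h1 : expect (mix ν a t) (fun x => |h x - h (update x i a)|) ≤
      expect (mix ν a t) (energy ν a i h) := by
    have : (fun x => |h x - h (update x i a)|) = fun x => (h x - h (update x i a)) ^ 2 := by
      funext x
      rcases hbool x with e | e <;> rcases hbool (update x i a) with e' | e' <;> simp [e, e']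
    rw [this, expect_sq_sub_update ν hν]
    nlinarith
  have h2 := expect_abs_avg_le hμ0 hμ i (fun x => h x - h (update x i a))
  rw [sub_avg_eq hμ a]
  have h3 := expect_mono hμ0 (fun x => abs_sub (h x - h (update x i a))
    (avg (mix ν a t) i (fun x => h x - h (update x i a)) x))
  rw [expect_add] at h3
  simp only [Pi.sub_apply]
  linarith

/-- The Efron–Stein inequality for a Boolean function with equal energies. -/
lemma variance_le_energy {ν : A → ℝ} {a : A} {t D : ℝ} (h0 : ∀ b, 0 ≤ ν b)
    (hν : ∑ b, ν b = 1) (ht0 : 0 ≤ t) (ht1 : t ≤ 1) {h : (Fin n → A) → ℝ}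
    (hbool : ∀ x, h x = 0 ∨ h x = 1)
    (hD : ∀ i, expect (mix ν a t) (energy ν a i h) = D) :
    expect (mix ν a t) h * (1 - expect (mix ν a t) h) ≤ n * D := by
  have hμ0 := mix_nonneg h0 a ht0 ht1
  have hμ := sum_mix hν a t
  rw [← sum_expect_sq_martingaleDiffs_bool hμ hbool]
  have := List.sum_le_card_nsmul ((martingaleDiffs (mix ν a t) (List.finRange n) h).map
    fun d => expect (mix ν a t) (fun x => d x ^ 2)) D ?_
  · simpa [length_martingaleDiffs] using this
  · intro y hy
    obtain ⟨d, hd, rfl⟩ := List.mem_map.1 hy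
    exact martingaleDiffs_le_of_contraction (fun g => expect (mix ν a t) (fun x => g x ^ 2))
      (expect_sq_avg_le hμ0 hμ) _ h
      (fun i => (expect_sq_sub_avg_le_energy h0 hν ht0 ht1 i h).trans_eq (hD i)) d hd

/-- The entropy estimate behind the logarithmic gain. -/
lemma variance_mul_log_le {ν : A → ℝ} {a : A} {t D κ : ℝ} (h0 : ∀ b, 0 ≤ ν b)
    (hν : ∑ b, ν b = 1) (ha : ν a = 0) (hκ : 0 < κ) (hκν : ∀ b, b ≠ a → κ ≤ ν b)
    (ht0 : 0 < t) (ht1 : t < 1) {h : (Fin n → A) → ℝ}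
    (hbool : ∀ x, h x = 0 ∨ h x = 1)
    (hD : ∀ i, expect (mix ν a t) (energy ν a i h) = D) (hn : 0 < n) (hD0 : 0 < D)
    (hV : 0 < expect (mix ν a t) h * (1 - expect (mix ν a t) h)) :
    expect (mix ν a t) h * (1 - expect (mix ν a t) h) *
        (2 * Real.log (expect (mix ν a t) h * (1 - expect (mix ν a t) h) / (2 * n * D)) -
          Real.log D) ≤
      4 / κ * (n * D) := by
  have hμ0 := mix_nonneg h0 a ht0.le ht1.le
  have hμ := sum_mix hν a t
  have hsum := sum_expect_sq_martingaleDiffs_bool hμ hbool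
  set μ := mix ν a t
  set V := expect μ h * (1 - expect μ h)
  set ds := martingaleDiffs μ (List.finRange n) h with hds
  have hnR : (0 : ℝ) < n := by exact_mod_cast hn
  -- Chosen so that the `n` error terms `4 * θ * D` sum to `2 * V`, cancelling the `+ 2` on the left
  -- of `hone` after summation.
  set θ := V / (2 * n * D) with hθ
  have hθ0 : 0 < θ := by positivity
  have hsq : ∀ d ∈ ds, expect μ (fun x => d x ^ 2) ≤ D :=
    martingaleDiffs_le_of_contraction (fun g => expect μ (fun x => g x ^ 2))
      (expect_sq_avg_le hμ0 hμ) _ h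
      (fun i => (expect_sq_sub_avg_le_energy h0 hν ht0.le ht1.le i h).trans_eq (hD i))
  have habs : ∀ d ∈ ds, expect μ (fun x => |d x|) ≤ 2 * D :=
    martingaleDiffs_le_of_contraction (fun g => expect μ (fun x => |g x|))
      (expect_abs_avg_le hμ0 hμ) _ h
      (fun i => (expect_abs_sub_avg_le_energy h0 hν ht0.le ht1.le i hbool).trans_eq
        (by rw [hD i]))
  have hone : ∀ d ∈ ds, (2 * Real.log θ - Real.log D + 2) * expect μ (fun x => d x ^ 2) ≤
      4 / κ * (∑ i, expect μ (energy ν a i d)) + 4 * θ * D := by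
    intro d hd
    have h1 := two_mul_log_sub_le hμ0 hθ0 d
    have h2 := expect_entropy_le hμ0 hμ h0 a (by positivity)
      (entropy_le_energy h0 hν ha hκ hκν ht0 ht1) d
    have h3 := mul_le_mul_of_nonneg_left (habs d hd) hθ0.le
    have hS0 : 0 ≤ expect μ (fun x => d x ^ 2) := expect_nonneg hμ0 fun x => sq_nonneg _
    have h4 : expect μ (fun x => d x ^ 2) * Real.log (expect μ (fun x => d x ^ 2)) ≤
        expect μ (fun x => d x ^ 2) * Real.log D := by
      rcases hS0.eq_or_lt with e | e
      · simp [← e]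
      · exact mul_le_mul_of_nonneg_left (Real.log_le_log e (hsq d hd)) hS0
    linarith
  have htot := List.sum_le_sum hone
  have e1 : (ds.map fun d => 4 / κ * (∑ i, expect μ (energy ν a i d)) + 4 * θ * D).sum =
      4 / κ * (∑ i, (ds.map fun d => expect μ (energy ν a i d)).sum) + n * (4 * θ * D) := by
    have : (n : ℝ) = ds.length := by simp [hds, length_martingaleDiffs]
    rw [this]
    clear htot hone habs hsq hsum this
    clear_value ds
    clear hds
    induction ds with
    | nil => simp
    | cons d ds ih =>
      simp only [List.map_cons, List.sum_cons, ih, Finset.sum_add_distrib, List.length_cons]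
      push_cast
      ring
  have e2 : ∑ i, (ds.map fun d => expect μ (energy ν a i d)).sum ≤ n * D := by
    have := Finset.sum_le_sum fun i (_ : i ∈ (univ : Finset (Fin n))) =>
      (sum_expect_energy_martingaleDiffs_le hμ0 hμ h0 a i (List.finRange n) h).trans_eq (hD i)
    simpa using this
  rw [List.sum_map_mul_left, hsum, e1] at htot
  have e3 : n * (4 * θ * D) = 2 * V := by rw [hθ]; field_simp; ring
  have e4 : 4 / κ * (∑ i, (ds.map fun d => expect μ (energy ν a i d)).sum) ≤
    4 / κ * (n * D) := mul_le_mul_of_nonneg_left e2 (by positivity)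
  linarith

/-- The total energy of a Boolean function with equal energies exceeds the variance by a
logarithmic factor. -/
lemma log_mul_variance_le_energy {ν : A → ℝ} {a : A} {t D κ : ℝ} (h0 : ∀ b, 0 ≤ ν b)
    (hν : ∑ b, ν b = 1) (ha : ν a = 0) (hκ : 0 ≤ κ) (hκν : ∀ b, b ≠ a → κ ≤ ν b)
    (ht0 : 0 < t) (ht1 : t < 1) {h : (Fin n → A) → ℝ}
    (hbool : ∀ x, h x = 0 ∨ h x = 1)
    (hD : ∀ i, expect (mix ν a t) (energy ν a i h) = D) (hn : 0 < n) :
    κ * Real.log n / 16 * (expect (mix ν a t) h * (1 - expect (mix ν a t) h)) ≤ n * D := by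
  have hμ0 := mix_nonneg h0 a ht0.le ht1.le
  have hVle := variance_le_energy h0 hν ht0.le ht1.le hbool hD
  have hnR : (1 : ℝ) ≤ n := by exact_mod_cast hn
  have hlog := Real.log_nonneg hnR
  have hD0 : 0 ≤ D := (expect_nonneg hμ0 (energy_nonneg h0 a ⟨0, hn⟩ h)).trans_eq (hD _)
  rcases hκ.eq_or_lt with rfl | hκ
  · simp only [zero_mul, zero_div]; positivity
  rcases le_or_gt (expect (mix ν a t) h * (1 - expect (mix ν a t) h)) 0 with hV | hV
  · exact (mul_nonpos_of_nonneg_of_nonpos (by positivity) hV).trans (by positivity)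
  have hD1 : 0 < D := by
    by_contra hc
    have : D = 0 := le_antisymm (not_lt.1 hc) hD0
    rw [this, mul_zero] at hVle
    linarith
  have hmain := variance_mul_log_le h0 hν ha hκ hκν ht0 ht1 hbool hD hn hD1 hV
  have hV4 : expect (mix ν a t) h * (1 - expect (mix ν a t) h) ≤ 1 / 4 := by
    nlinarith [sq_nonneg (expect (mix ν a t) h - 1 / 2)]
  have hκ1 : κ ≤ 1 := by
    obtain ⟨b₀, hb₀⟩ : ∃ b, b ≠ a := by
      by_contra! hall
      have : ∑ b, ν b = 0 := Finset.sum_eq_zero fun b _ => by rw [hall b, ha]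
      linarith
    exact (hκν b₀ hb₀).trans
      ((Finset.single_le_sum (fun b _ => h0 b) (mem_univ b₀)).trans_eq hν)
  set V := expect (mix ν a t) h * (1 - expect (mix ν a t) h)
  clear_value V
  have hn0 : (0 : ℝ) < n := by linarith
  have hlogV : Real.log V ≤ -(2 * Real.log 2) := by
    have := Real.log_le_log hV hV4
    rwa [one_div, Real.log_inv, show (4 : ℝ) = 2 ^ 2 by norm_num, Real.log_pow,
      Nat.cast_ofNat] at this
  rw [Real.log_div hV.ne' (by positivity), Real.log_mul (by positivity) hD1.ne',
    Real.log_mul (by positivity) (by positivity)] at hmain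
  -- The threshold is `D = V n ^ (-3/4)`. Below it, the logarithms in `hmain` leave `(3 * 3/4 - 2)
  -- log n = (1/4) log n`, the terms `-log V - 2 log 2` being nonnegative because `V ≤ 1/4`. Above
  -- it, `n D / V` exceeds `n ^ (1/4)`, hence `(1/4) log n`.
  rcases le_or_gt (Real.log D) (Real.log V - 3 / 4 * Real.log n) with hc | hc
  · have h1 : V * (1 / 4 * Real.log n) ≤ 4 / κ * (n * D) := by
      refine le_trans (mul_le_mul_of_nonneg_left ?_ hV.le) hmain
      linarith
    rw [div_mul_eq_mul_div 4, le_div_iff₀ hκ] at h1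
    linarith
  · have h1 := Real.log_le_sub_one_of_pos (show 0 < n * D / V by positivity)
    rw [Real.log_div (by positivity) hV.ne', Real.log_mul (by positivity) hD1.ne'] at h1
    have h2 : 1 / 4 * Real.log n ≤ n * D / V := by linarith
    rw [le_div_iff₀ hV] at h2
    have h3 : κ * (Real.log n * V) ≤ 1 * (Real.log n * V) := by gcongr
    have h4 : 0 ≤ Real.log n * V := by positivity
    linarith

end Variance

/-! ### Russo's formula and transition windows on segments. -/

section Derivative

/-- Logistic growth at rate `lam` forces a short transition window. -/
lemma window_le_of_logistic {p p' : ℝ → ℝ} {lam ε s t : ℝ} (hlam : 0 ≤ lam) (hε : 0 < ε)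
    (hp : ∀ x, HasDerivAt p (p' x) x) (hs : 0 ≤ s) (ht : t ≤ 1) (hst : s ≤ t)
    (hp01 : ∀ x ∈ Set.Icc (0 : ℝ) 1, p x ∈ Set.Icc (0 : ℝ) 1)
    (hgrow : ∀ x ∈ Set.Ioo (0 : ℝ) 1, lam * (p x * (1 - p x)) ≤ p' x)
    (hεs : ε ≤ p s) (hεt : p t ≤ 1 - ε) :
    lam * (t - s) ≤ 2 * (Real.log (1 - ε) - Real.log ε) := by
  have hcont : Continuous p := continuous_iff_continuousAt.2 fun x => (hp x).continuousAt
  have hmem : ∀ x ∈ interior (Set.Icc s t), x ∈ Set.Ioo (0 : ℝ) 1 := by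
    intro x hx
    rw [interior_Icc] at hx
    exact ⟨hs.trans_lt hx.1, hx.2.trans_le ht⟩
  have hmono : MonotoneOn p (Set.Icc s t) := by
    refine monotoneOn_of_deriv_nonneg (convex_Icc s t) hcont.continuousOn
      (fun x _ => (hp x).differentiableAt.differentiableWithinAt) fun x hx => ?_
    rw [(hp x).deriv]
    have h1 := hp01 x (Set.Ioo_subset_Icc_self (hmem x hx))
    exact (mul_nonneg hlam (mul_nonneg h1.1 (sub_nonneg.2 h1.2))).trans (hgrow x (hmem x hx))
  have hin : ∀ x ∈ Set.Icc s t, ε ≤ p x ∧ p x ≤ 1 - ε := fun x hx =>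
    ⟨hεs.trans (hmono (Set.left_mem_Icc.2 hst) hx hx.1),
      (hmono hx (Set.right_mem_Icc.2 hst) hx.2).trans hεt⟩
  -- The log-odds linearise logistic growth: their derivative is `p' / (p (1 - p)) ≥ lam`.
  have hder : ∀ x ∈ Set.Icc s t, HasDerivAt (fun x => Real.log (p x) - Real.log (1 - p x))
      (p' x / p x - -p' x / (1 - p x)) x := by
    intro x hx
    have h1 := hin x hx
    exact ((hp x).log (by linarith)).sub (((hp x).const_sub 1).log (by linarith))
  have hkey := (convex_Icc s t).mul_sub_le_image_sub_of_le_deriv (C := lam)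
    (f := fun x => Real.log (p x) - Real.log (1 - p x))
    (fun x hx => (hder x hx).continuousAt.continuousWithinAt)
    (fun x hx => (hder x (interior_subset hx)).differentiableAt.differentiableWithinAt)
    (fun x hx => by
      rw [(hder x (interior_subset hx)).deriv]
      have h1 := hin x (interior_subset hx)
      have h2 : 0 < p x := by linarith
      have h3 : 0 < 1 - p x := by linarith
      have h4 : p' x / p x - -p' x / (1 - p x) = p' x / (p x * (1 - p x)) := by
        field_simp; ring
      rw [h4, le_div_iff₀ (mul_pos h2 h3)]
      exact hgrow x (hmem x hx))
    s (Set.left_mem_Icc.2 hst) t (Set.right_mem_Icc.2 hst) hst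
  have h1 := hin s (Set.left_mem_Icc.2 hst)
  have h2 := hin t (Set.right_mem_Icc.2 hst)
  have h3 := Real.log_le_log hε h1.1
  have h4 := Real.log_le_log (by linarith) h2.2
  have h5 := Real.log_le_log (by linarith) (show ε ≤ 1 - p t by linarith)
  have h6 := Real.log_le_log (by linarith) (show 1 - p s ≤ 1 - ε by linarith)
  linarith

variable {A : Type*} [Fintype A] {n : ℕ}

lemma expect_comp_perm (μ : A → ℝ) (σ : Equiv.Perm (Fin n)) (g : (Fin n → A) → ℝ) :
    expect μ (fun x => g (x ∘ σ)) = expect μ g := by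
  unfold expect
  rw [← Equiv.sum_comp (σ.symm.arrowCongr (Equiv.refl A)) fun x => (∏ i, μ (x i)) * g x]
  refine Finset.sum_congr rfl fun x _ => ?_
  congr 1
  exact (Equiv.prod_comp σ fun i => μ (x i)).symm

/-- Carries an invariance of `g` over to its energies; with transitivity, all coordinates then have
the same energy. -/
lemma expect_energy_comp_perm (μ ν : A → ℝ) (a : A) {σ : Equiv.Perm (Fin n)}
    {g : (Fin n → A) → ℝ} (hg : ∀ x, g (x ∘ σ) = g x) (i : Fin n) :
    expect μ (energy ν a (σ i) g) = expect μ (energy ν a i g) := by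
  rw [← expect_comp_perm μ σ (energy ν a i g)]
  congr 1
  funext x
  unfold energy
  refine Finset.sum_congr rfl fun b _ => ?_
  rw [← hg (update x (σ i) b), ← hg (update x (σ i) a), update_comp_equiv, update_comp_equiv,
    Equiv.symm_apply_apply]

lemma productProb_eq_expect (μ : A → ℝ) (E : Set (Fin n → A)) :
    productProb μ E = expect μ (E.indicator fun _ => 1) := by
  classical
  unfold productProb expect
  exact Finset.sum_congr rfl fun x _ => by simp [Set.indicator_apply]

variable [DecidableEq A]

/-- Russo's formula along the segment from `ν` to `δ_a`. -/
lemma hasDerivAt_expect_mix {ν : A → ℝ} {a : A} (hν : ∑ b, ν b = 1)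
    {h : (Fin n → A) → ℝ} (hbool : ∀ x, h x = 0 ∨ h x = 1)
    (hmono : ∀ x i, h x ≤ h (update x i a)) (t : ℝ) :
    HasDerivAt (fun t => expect (mix ν a t) h)
      (∑ i, expect (mix ν a t) (energy ν a i h)) t := by
  set τ : A → ℝ := fun b => -ν b + Pi.single (M := fun _ => ℝ) a 1 b with hτ
  have h1 : ∀ b, HasDerivAt (fun t => mix ν a t b) (τ b) t := by
    intro b
    have := (((hasDerivAt_id t).const_sub 1).mul_const (ν b)).add
      ((hasDerivAt_id t).mul_const (Pi.single (M := fun _ => ℝ) a 1 b))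
    exact this.congr_deriv (by simp [hτ])
  have h2 : HasDerivAt (fun t => expect (mix ν a t) h)
      (∑ x, (∑ i, (∏ j ∈ univ.erase i, mix ν a t (x j)) • τ (x i)) * h x) t := by
    unfold expect
    exact HasDerivAt.fun_sum fun x _ =>
      (HasDerivAt.fun_finsetProd fun i _ => h1 (x i)).mul_const (h x)
  convert h2 using 1
  simp only [Finset.sum_mul, smul_eq_mul]
  rw [Finset.sum_comm]
  refine Finset.sum_congr rfl fun i _ => ?_
  rw [← expect_resample (sum_mix hν a t)]
  congr 1
  funext x
  have e1 : ∑ c, τ c * h (update x i c) = h (update x i a) - ∑ c, ν c * h (update x i c) := by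
    simp only [hτ, add_mul, Finset.sum_add_distrib, neg_mul, Finset.sum_neg_distrib]
    rw [Finset.sum_eq_single (a := a) (s := univ)
      (f := fun c => Pi.single (M := fun _ => ℝ) a 1 c * h (update x i c))
      (by simp +contextual) (by simp)]
    simp only [Pi.single_eq_same, one_mul]
    ring
  have e2 : h (update x i a) = ∑ c, ν c * h (update x i a) := by
    rw [← Finset.sum_mul, hν, one_mul]
  rw [e1, e2, ← Finset.sum_sub_distrib]
  refine Finset.sum_congr rfl fun c _ => ?_
  rw [← mul_sub]
  congr 1
  have := hmono (update x i c) i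
  rw [update_idem] at this
  -- For a monotone Boolean function the increment on changing a letter to `a` is `0` or `1`, hence
  -- equals its square.
  rcases hbool (update x i c) with e | e <;> rcases hbool (update x i a) with e' | e' <;>
    rw [e, e'] at this ⊢ <;> first | (exfalso; linarith) | norm_num

/-- On every segment ending in `δ_a` the transition window of `P[f = a]` is short. -/
lemma window_le {f : (Fin n → A) → A} (hn : 0 < n) (hsymm : IsSymmetric f) (hmon : IsMonotone f)
    {ν : A → ℝ} {a : A} (h0 : ∀ b, 0 ≤ ν b) (hν : ∑ b, ν b = 1) (ha : ν a = 0) {κ : ℝ}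
    (hκ : 0 ≤ κ) (hκν : ∀ b, b ≠ a → κ ≤ ν b) {ε s t : ℝ} (hε : 0 < ε) (hs : 0 ≤ s)
    (hst : s ≤ t) (ht : t ≤ 1) (hεs : ε ≤ productProb (mix ν a s) {x | f x = a})
    (hεt : productProb (mix ν a t) {x | f x = a} ≤ 1 - ε) :
    max 1 (κ * Real.log n / 16) * (t - s) ≤ 2 * (Real.log (1 - ε) - Real.log ε) := by
  simp only [productProb_eq_expect] at hεs hεt
  set h : (Fin n → A) → ℝ := ({x | f x = a} : Set (Fin n → A)).indicator fun _ => 1 with hh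
  have hbool : ∀ x, h x = 0 ∨ h x = 1 := fun x => by
    by_cases hx : f x = a <;> simp [hh, hx]
  have hmono : ∀ x i, h x ≤ h (update x i a) := by
    intro x i
    by_cases hx : f x = a
    · have : f (update x i a) = a := by
        refine hmon a x _ ⟨fun j hj => ?_, fun j hj => ?_⟩ hx
        · rcases eq_or_ne j i with rfl | hji
          · simp
          · simpa [update_of_ne hji] using hj
        · rcases eq_or_ne j i with rfl | hji
          · simp at hj
          · rw [update_of_ne hji]
      simp [hh, hx, this]
    · rcases hbool (update x i a) with e | e <;> rw [e] <;> simp [hh, hx]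
  obtain ⟨G, hG, hinv⟩ := hsymm
  have hDeq : ∀ x i, expect (mix ν a x) (energy ν a i h) =
      expect (mix ν a x) (energy ν a ⟨0, hn⟩ h) := by
    intro x i
    obtain ⟨g, hg⟩ := hG.exists_smul_eq ⟨0, hn⟩ i
    have hgi : (g : Equiv.Perm (Fin n)) ⟨0, hn⟩ = i := hg
    rw [← hgi]
    refine expect_energy_comp_perm _ _ _ (fun y => ?_) _
    have hf : f (y ∘ (g : Equiv.Perm (Fin n))) = f y := hinv g g.2 y
    simp only [hh, Set.indicator_apply, Set.mem_ofPred_eq, hf]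
  have hnD : ∀ x, ∑ i, expect (mix ν a x) (energy ν a i h) =
      n * expect (mix ν a x) (energy ν a ⟨0, hn⟩ h) := by
    intro x
    rw [Finset.sum_congr rfl fun i _ => hDeq x i]
    simp
  refine window_le_of_logistic (by positivity) hε (hasDerivAt_expect_mix hν hbool hmono) hs ht hst
    (fun x hx => ?_) (fun x hx => ?_) hεs hεt
  · have hμ0 := mix_nonneg h0 a hx.1 hx.2
    refine ⟨expect_nonneg hμ0 fun y => ?_, ?_⟩
    · rcases hbool y with e | e <;> simp [e]
    · refine (expect_mono hμ0 fun y => ?_).trans_eq (expect_const (sum_mix hν a x) 1)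
      rcases hbool y with e | e <;> simp [e]
  · rw [hnD]
    rcases max_cases 1 (κ * Real.log n / 16) with ⟨e, _⟩ | ⟨e, _⟩ <;> rw [e]
    · rw [one_mul]
      exact variance_le_energy h0 hν hx.1.le hx.2.le hbool (hDeq x)
    · exact log_mul_variance_le_energy h0 hν ha hκ hκν hx.1 hx.2 hbool (hDeq x) hn

end Derivative

/-! ### Integration along rays. -/

section Polar

variable {B : Type*} [Fintype B]

/-- Integration along rays: the volume of a subset of the unit ball is controlled by the lengths
of its intersections with the rays through the shell `1 / 2 < ‖y‖ ≤ 1`. -/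
lemma volume_le_lintegral_rays [Nonempty B] {E : Set (B → ℝ)} (hE : MeasurableSet E)
    (hball : ∀ y ∈ E, ‖y‖ ≤ 1) :
    volume E ≤ 2 ^ Fintype.card B *
      ∫⁻ y in {y : B → ℝ | 1 / 2 < ‖y‖ ∧ ‖y‖ ≤ 1},
        volume {r : ℝ | r ∈ Set.Ioc 0 2 ∧ r • y ∈ E} := by
  set m := Fintype.card B with hm
  have hm1 : 1 ≤ m := Fintype.card_pos
  set S : Set (B → ℝ) := {y | 1 / 2 < ‖y‖ ∧ ‖y‖ ≤ 1} with hS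
  have hSm : MeasurableSet S := by
    have h1 : MeasurableSet {y : B → ℝ | 1 / 2 < ‖y‖} :=
      measurableSet_lt measurable_const measurable_norm
    have h2 : MeasurableSet {y : B → ℝ | ‖y‖ ≤ 1} :=
      measurableSet_le measurable_norm measurable_const
    exact h1.inter h2
  set K : Set (ℝ × (B → ℝ)) := {p | p.1 ∈ Set.Ioc 0 2 ∧ p.2 ∈ S ∧ p.1 • p.2 ∈ E} with hK
  have hKm : MeasurableSet K := by
    have h1 : MeasurableSet {p : ℝ × (B → ℝ) | p.1 ∈ Set.Ioc (0 : ℝ) 2} :=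
      measurable_fst measurableSet_Ioc
    have h2 : MeasurableSet {p : ℝ × (B → ℝ) | p.2 ∈ S} := measurable_snd hSm
    have h3 : MeasurableSet {p : ℝ × (B → ℝ) | p.1 • p.2 ∈ E} :=
      (measurable_fst.smul measurable_snd) hE
    exact h1.inter (h2.inter h3)
  have hright : ∫⁻ y in S, volume {r : ℝ | r ∈ Set.Ioc 0 2 ∧ r • y ∈ E} =
      (volume.prod volume) K := by
    rw [Measure.prod_apply_symm hKm, ← lintegral_indicator hSm]
    refine lintegral_congr fun y => ?_
    by_cases hy : y ∈ S
    · rw [Set.indicator_of_mem hy]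
      congr 1
      ext r
      simp [hK, hy]
    · rw [Set.indicator_of_notMem hy]
      have : (fun x => (x, y)) ⁻¹' K = ∅ := by
        ext r; simp [hK, hy]
      rw [this, measure_empty]
  have hswap : (volume.prod volume) K =
      ∫⁻ z, ∫⁻ r, {p : ℝ × (B → ℝ) | p.1 ∈ Set.Ioc 0 2 ∧ p.1⁻¹ • p.2 ∈ S ∧ p.2 ∈ E}.indicator
        (fun p => ENNReal.ofReal ((p.1 ^ m)⁻¹)) (r, z) := by
    have hK' : MeasurableSet
        {p : ℝ × (B → ℝ) | p.1 ∈ Set.Ioc 0 2 ∧ p.1⁻¹ • p.2 ∈ S ∧ p.2 ∈ E} := by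
      have h1 : MeasurableSet {p : ℝ × (B → ℝ) | p.1 ∈ Set.Ioc (0 : ℝ) 2} :=
        measurable_fst measurableSet_Ioc
      have h2 : MeasurableSet {p : ℝ × (B → ℝ) | p.1⁻¹ • p.2 ∈ S} :=
        (measurable_fst.inv.smul measurable_snd) hSm
      have h3 : MeasurableSet {p : ℝ × (B → ℝ) | p.2 ∈ E} := measurable_snd hE
      exact h1.inter (h2.inter h3)
    rw [Measure.prod_apply hKm, ← lintegral_lintegral_swap]
    · refine lintegral_congr fun r => ?_
      by_cases hr : r ∈ Set.Ioc (0 : ℝ) 2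
      · have hr0 : r ≠ 0 := hr.1.ne'
        have hset : MeasurableSet {z : B → ℝ | r⁻¹ • z ∈ S ∧ z ∈ E} :=
          ((measurable_const_smul r⁻¹) hSm).inter hE
        have e1 : Prod.mk r ⁻¹' K = (r • ·) ⁻¹' {z : B → ℝ | r⁻¹ • z ∈ S ∧ z ∈ E} := by
          ext y
          simp only [hK, Set.mem_preimage, Set.mem_ofPred_eq, hr, true_and, smul_smul,
            inv_mul_cancel₀ hr0, one_smul]
        -- Substituting `z = r • y` at fixed `r` gives the Jacobian `r ^ (-m)`.
        rw [e1, Measure.addHaar_preimage_smul _ hr0]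
        have e2 : ∀ z, {p : ℝ × (B → ℝ) | p.1 ∈ Set.Ioc 0 2 ∧ p.1⁻¹ • p.2 ∈ S ∧ p.2 ∈ E}.indicator
            (fun p => ENNReal.ofReal ((p.1 ^ m)⁻¹)) (r, z) =
            {z : B → ℝ | r⁻¹ • z ∈ S ∧ z ∈ E}.indicator
              (fun _ => ENNReal.ofReal ((r ^ m)⁻¹)) z := by
          intro z
          have : (r, z) ∈ {p : ℝ × (B → ℝ) | p.1 ∈ Set.Ioc 0 2 ∧ p.1⁻¹ • p.2 ∈ S ∧ p.2 ∈ E} ↔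
              z ∈ {z : B → ℝ | r⁻¹ • z ∈ S ∧ z ∈ E} := by
            simp [hr.1, hr.2]
          by_cases hz : z ∈ {z : B → ℝ | r⁻¹ • z ∈ S ∧ z ∈ E}
          · rw [Set.indicator_of_mem hz, Set.indicator_of_mem (this.2 hz)]
          · rw [Set.indicator_of_notMem hz, Set.indicator_of_notMem (fun h => hz (this.1 h))]
        simp_rw [e2]
        rw [lintegral_indicator_const hset, Module.finrank_pi,
          abs_of_nonneg (inv_nonneg.2 (pow_nonneg hr.1.le _))]
      · have e1 : Prod.mk r ⁻¹' K = ∅ := by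
          ext y
          simp only [hK, Set.mem_preimage, Set.mem_ofPred_eq, hr, false_and,
            Set.mem_empty_iff_false]
        rw [e1, measure_empty]
        symm
        rw [lintegral_eq_zero_iff']
        · refine Filter.Eventually.of_forall fun z => ?_
          exact Set.indicator_of_notMem (fun h => hr h.1) _
        · exact (Measurable.comp (Measurable.indicator (by fun_prop) hK')
            measurable_prodMk_left).aemeasurable
    · exact (Measurable.indicator (by fun_prop) hK').aemeasurable
  have hlow : ∀ z, z ≠ 0 → E.indicator (fun _ => ENNReal.ofReal ((2 ^ m)⁻¹)) z ≤
      ∫⁻ r, {p : ℝ × (B → ℝ) | p.1 ∈ Set.Ioc 0 2 ∧ p.1⁻¹ • p.2 ∈ S ∧ p.2 ∈ E}.indicator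
        (fun p => ENNReal.ofReal ((p.1 ^ m)⁻¹)) (r, z) := by
    intro z hz
    by_cases hzE : z ∈ E
    · rw [Set.indicator_of_mem hzE]
      have hz0 : 0 < ‖z‖ := norm_pos_iff.2 hz
      have hz1 := hball z hzE
      -- The point `z` is reached from the shell for every `r` in `[‖z‖, 2‖z‖)`, an interval of
      -- length `‖z‖` on which the Jacobian is at least `(2‖z‖) ^ (-m)`. As `‖z‖ ≤ 1` and `m ≥ 1`,
      -- the product is at least `2 ^ (-m)`.
      calc ENNReal.ofReal ((2 ^ m)⁻¹)
          ≤ ENNReal.ofReal (((2 * ‖z‖) ^ m)⁻¹) * ENNReal.ofReal ‖z‖ := by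
            rw [← ENNReal.ofReal_mul (by positivity)]
            refine ENNReal.ofReal_le_ofReal ?_
            rw [inv_mul_eq_div, le_div_iff₀ (by positivity), mul_pow, inv_mul_cancel_left₀
              (by positivity)]
            exact pow_le_of_le_one hz0.le hz1 (by omega)
        _ = ∫⁻ r in Set.Ico ‖z‖ (2 * ‖z‖), ENNReal.ofReal (((2 * ‖z‖) ^ m)⁻¹) := by
            rw [setLIntegral_const, Real.volume_Ico]
            congr 2
            ring
        _ ≤ _ := by
            rw [← lintegral_indicator measurableSet_Ico]
            refine lintegral_mono fun r => ?_
            by_cases hr : r ∈ Set.Ico ‖z‖ (2 * ‖z‖)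
            · have hr0 : 0 < r := hz0.trans_le hr.1
              rw [Set.indicator_of_mem hr, Set.indicator_of_mem]
              · refine ENNReal.ofReal_le_ofReal ?_
                have := hr.2.le
                simp only
                gcongr
              · refine ⟨⟨hr0, by linarith [hr.2]⟩, ⟨?_, ?_⟩, hzE⟩ <;>
                  rw [norm_smul, norm_inv, Real.norm_of_nonneg hr0.le, inv_mul_eq_div]
                · rw [div_lt_div_iff₀ two_pos hr0]
                  linarith [hr.2]
                · rw [div_le_one hr0]
                  exact hr.1
            · rw [Set.indicator_of_notMem hr]
              exact zero_le
    · rw [Set.indicator_of_notMem hzE]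
      exact zero_le
  have hae : ∀ᵐ z : B → ℝ, z ≠ 0 := by
    rw [ae_iff]; simp
  have hfin := lintegral_mono_ae (hae.mono hlow)
  rw [lintegral_indicator_const hE, ← hswap] at hfin
  rw [hright]
  calc volume E = 2 ^ m * (ENNReal.ofReal ((2 ^ m)⁻¹) * volume E) := by
        rw [← mul_assoc, ENNReal.ofReal_inv_of_pos (by positivity),
          ENNReal.ofReal_pow (by norm_num), ENNReal.ofReal_ofNat,
          ENNReal.mul_inv_cancel (by positivity) (by finiteness), one_mul]
    _ ≤ _ := by gcongr

end Polar

/-! ### Integrating the window lengths. -/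

section Integral

/-- The truncated logarithmic integral. -/
lemma lintegral_inv_max_le {ℓ k : ℝ} (hℓ : 1 < ℓ) (hk : 0 < k) :
    ∫⁻ s in Set.Icc (0 : ℝ) 1, ENNReal.ofReal (1 / max 1 (s * ℓ / k)) ≤
      ENNReal.ofReal (1 / ℓ + k * Real.log ℓ / ℓ) := by
  have hℓ0 : 0 < ℓ := by linarith
  have hδ1 : ℓ⁻¹ ≤ 1 := inv_le_one_of_one_le₀ hℓ.le
  have hδ0 : 0 < ℓ⁻¹ := by positivity
  have hlog := Real.log_nonneg hℓ.le
  -- Cut at `1 / ℓ`: below it bound the integrand by `1`, above it by `k / (ℓ s)`, whose integral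
  -- produces `log ℓ`.
  rw [← Set.Icc_union_Icc_eq_Icc hδ0.le hδ1]
  refine (lintegral_union_le _ _ _).trans ?_
  rw [ENNReal.ofReal_add (by positivity) (by positivity)]
  refine add_le_add ?_ ?_
  · calc _ ≤ ∫⁻ s in Set.Icc 0 ℓ⁻¹, 1 := by
          refine lintegral_mono fun s => ?_
          rw [← ENNReal.ofReal_one]
          refine ENNReal.ofReal_le_ofReal ?_
          exact div_le_one_of_le₀ (le_max_left _ _) (by positivity)
      _ = _ := by simp
  · have hint : IntervalIntegrable (fun s : ℝ => k / ℓ * s⁻¹) volume ℓ⁻¹ 1 := by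
      refine (intervalIntegral.intervalIntegrable_inv (fun x hx => ?_) continuousOn_id).const_mul _
      rw [Set.uIcc_of_le hδ1] at hx
      exact (hδ0.trans_le hx.1).ne'
    have hint' : IntegrableOn (fun s : ℝ => k / ℓ * s⁻¹) (Set.Icc ℓ⁻¹ 1) :=
      (intervalIntegrable_iff_integrableOn_Icc_of_le hδ1).1 hint
    calc _ ≤ ∫⁻ s in Set.Icc ℓ⁻¹ 1, ENNReal.ofReal (k / ℓ * s⁻¹) := by
          refine setLIntegral_mono' measurableSet_Icc fun s hs => ?_
          have hs0 : 0 < s := hδ0.trans_le hs.1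
          refine ENNReal.ofReal_le_ofReal ?_
          calc 1 / max 1 (s * ℓ / k) ≤ 1 / (s * ℓ / k) :=
                one_div_le_one_div_of_le (by positivity) (le_max_right _ _)
            _ = _ := by field_simp
      _ = ENNReal.ofReal (∫ s in Set.Icc ℓ⁻¹ 1, k / ℓ * s⁻¹) := by
          rw [ofReal_integral_eq_lintegral_ofReal hint']
          refine (ae_restrict_iff' measurableSet_Icc).2 (Filter.Eventually.of_forall ?_)
          intro s hs
          have hs0 : 0 < s := hδ0.trans_le hs.1
          show 0 ≤ k / ℓ * s⁻¹
          positivity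
      _ ≤ _ := by
          refine ENNReal.ofReal_le_ofReal (le_of_eq ?_)
          rw [integral_Icc_eq_integral_Ioc, ← intervalIntegral.integral_of_le hδ1,
            intervalIntegral.integral_const_mul, integral_inv_of_pos hδ0 one_pos, one_div, inv_inv]
          ring

lemma lintegral_cube_eval {B : Type*} [Fintype B] {g : ℝ → ENNReal} (hg : Measurable g) (b : B) :
    ∫⁻ y in Set.Icc (0 : B → ℝ) 1, g (y b) = ∫⁻ s in Set.Icc (0 : ℝ) 1, g s := by
  have : IsProbabilityMeasure (volume.restrict (Set.Icc (0 : ℝ) 1)) := ⟨by simp⟩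
  have h : volume.restrict (Set.Icc (0 : B → ℝ) 1) =
      Measure.pi fun _ => volume.restrict (Set.Icc (0 : ℝ) 1) := by
    rw [← Set.pi_univ_Icc, volume_pi, Measure.restrict_pi_pi]
    rfl
  rw [h]
  exact (measurePreserving_eval (fun _ : B => volume.restrict (Set.Icc (0 : ℝ) 1)) b).lintegral_comp
    hg

/-- A subset of the corner simplex which meets every ray in a short set has small volume. -/
lemma volume_le_of_ray_windows {B : Type*} [Fintype B] [Nonempty B] {E : Set (B → ℝ)}
    (hE : MeasurableSet E) (hE0 : ∀ y ∈ E, ∀ b, 0 ≤ y b) (hE1 : ∀ y ∈ E, ∑ b, y b ≤ 1)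
    {ℓ M : ℝ} (hℓ : 1 < ℓ) (hM : 0 ≤ M)
    (hray : ∀ y : B → ℝ, (∀ b, 0 ≤ y b) → 0 < ∑ b, y b → ∀ κ, 0 ≤ κ →
      (∀ b, κ * ∑ c, y c ≤ y b) → ∀ r r', 0 < r → r ≤ r' → r • y ∈ E → r' • y ∈ E →
      max 1 (κ * ℓ / 16) * ((r' - r) * ∑ b, y b) ≤ M) :
    volume E ≤ 2 ^ Fintype.card B * (Fintype.card B * ENNReal.ofReal
      (2 * M * (1 / ℓ + 16 * Fintype.card B * Real.log ℓ / ℓ))) := by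
  have hm : (0 : ℝ) < Fintype.card B := by exact_mod_cast Fintype.card_pos
  have hball : ∀ y ∈ E, ‖y‖ ≤ 1 := by
    intro y hy
    refine (pi_norm_le_iff_of_nonneg zero_le_one).2 fun b => ?_
    rw [Real.norm_of_nonneg (hE0 y hy b)]
    exact (Finset.single_le_sum (fun c _ => hE0 y hy c) (mem_univ b)).trans (hE1 y hy)
  set G : ℝ → ENNReal := fun s =>
    ENNReal.ofReal (2 * M) * ENNReal.ofReal (1 / max 1 (s * ℓ / (16 * Fintype.card B))) with hG
  have hGm : Measurable G := by fun_prop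
  refine (volume_le_lintegral_rays hE hball).trans ?_
  gcongr
  have hSm : MeasurableSet {y : B → ℝ | 1 / 2 < ‖y‖ ∧ ‖y‖ ≤ 1} :=
    (measurableSet_lt measurable_const measurable_norm).inter
      (measurableSet_le measurable_norm measurable_const)
  calc ∫⁻ y in {y : B → ℝ | 1 / 2 < ‖y‖ ∧ ‖y‖ ≤ 1},
        volume {r : ℝ | r ∈ Set.Ioc 0 2 ∧ r • y ∈ E}
      ≤ ∫⁻ y in Set.Icc (0 : B → ℝ) 1, ∑ b, G (y b) := by
        rw [← lintegral_indicator hSm, ← lintegral_indicator measurableSet_Icc]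
        refine lintegral_mono fun y => ?_
        by_cases hy : y ∈ {y : B → ℝ | 1 / 2 < ‖y‖ ∧ ‖y‖ ≤ 1}
        swap
        · rw [Set.indicator_of_notMem hy]; exact zero_le
        rw [Set.indicator_of_mem hy]
        rcases Set.eq_empty_or_nonempty {r : ℝ | r ∈ Set.Ioc 0 2 ∧ r • y ∈ E} with he | ⟨r₀, hr₀⟩
        · rw [he, measure_empty]; exact zero_le
        have hy0 : ∀ b, 0 ≤ y b := fun b => by
          have := hE0 _ hr₀.2 b
          rw [Pi.smul_apply, smul_eq_mul] at this
          exact nonneg_of_mul_nonneg_right this hr₀.1.1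
        have hyle : ∀ b, y b ≤ 1 := fun b =>
          (le_abs_self _).trans ((norm_le_pi_norm y b).trans hy.2)
        have hsum : 1 / 2 < ∑ b, y b := by
          obtain ⟨b, hb⟩ : ∃ b, 1 / 2 < y b := by
            by_contra! hcon
            exact absurd hy.1 (not_lt.2 ((pi_norm_le_iff_of_nonneg (by norm_num)).2
              fun b => by rw [Real.norm_of_nonneg (hy0 b)]; exact hcon b))
          exact hb.trans_le (Finset.single_le_sum (fun c _ => hy0 c) (mem_univ b))
        have hsum' : ∑ b, y b ≤ Fintype.card B := by
          simpa using Finset.sum_le_sum fun b (_ : b ∈ univ) => hyle b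
        have hyc : y ∈ Set.Icc (0 : B → ℝ) 1 := ⟨fun b => hy0 b, fun b => hyle b⟩
        rw [Set.indicator_of_mem hyc]
        -- The smallest coordinate governs the rate; since `∑ y ≤ |B|`, the value `κ = y b₀ / |B|`
        -- is admissible. Summing `G (y b)` over all `b` removes the dependence of `b₀` on `y`.
        obtain ⟨b₀, -, hb₀⟩ := Finset.exists_min_image univ y Finset.univ_nonempty
        refine le_trans ?_ (Finset.single_le_sum (f := fun b => G (y b))
          (fun b _ => zero_le) (mem_univ b₀))
        have hκ : ∀ b, y b₀ / Fintype.card B * ∑ c, y c ≤ y b := by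
          intro b
          refine le_trans ?_ (hb₀ b (mem_univ b))
          rw [div_mul_eq_mul_div, div_le_iff₀ hm]
          exact mul_le_mul_of_nonneg_left hsum' (hy0 b₀)
        refine (Real.volume_le_diam _).trans (Metric.ediam_le fun r hr r' hr' => ?_)
        have hmax : 0 < max 1 (y b₀ * ℓ / (16 * Fintype.card B)) := by positivity
        have key : ∀ r r', 0 < r → r ≤ r' → r • y ∈ E → r' • y ∈ E →
            r' - r ≤ 2 * M * (1 / max 1 (y b₀ * ℓ / (16 * Fintype.card B))) := by
          intro r r' h0 hrr hr hr'
          have := hray y hy0 (by linarith) _ (div_nonneg (hy0 b₀) hm.le) hκ r r' h0 hrr hr hr'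
          rw [show y b₀ / Fintype.card B * ℓ / 16 = y b₀ * ℓ / (16 * Fintype.card B) by
            field_simp] at this
          rw [mul_one_div, le_div_iff₀ hmax]
          have h1 : (r' - r) * max 1 (y b₀ * ℓ / (16 * Fintype.card B)) * (1 / 2) ≤
              (r' - r) * max 1 (y b₀ * ℓ / (16 * Fintype.card B)) * ∑ b, y b := by
            have : 0 ≤ r' - r := by linarith
            gcongr
          linarith
        simp only [hG]
        rw [← ENNReal.ofReal_mul (by positivity), edist_dist]
        refine ENNReal.ofReal_le_ofReal ?_
        rw [Real.dist_eq]
        rcases le_total r r' with h | h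
        · rw [abs_sub_comm, abs_of_nonneg (by linarith)]
          exact key r r' hr.1.1 h hr.2 hr'.2
        · rw [abs_of_nonneg (by linarith)]
          exact key r' r hr'.1.1 h hr'.2 hr.2
    _ = ∑ b : B, ∫⁻ s in Set.Icc (0 : ℝ) 1, G s := by
        rw [lintegral_finsetSum _ fun b _ => by fun_prop]
        exact Finset.sum_congr rfl fun b _ => lintegral_cube_eval hGm b
    _ ≤ _ := by
        rw [Finset.sum_const, Finset.card_univ, nsmul_eq_mul]
        gcongr
        rw [hG, lintegral_const_mul _ (by fun_prop),
          ENNReal.ofReal_mul (p := 2 * M) (by positivity)]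
        gcongr
        exact lintegral_inv_max_le hℓ (by positivity)

end Integral

/-! ### Corner coordinates and the uniform measure on the simplex. -/

section Simplex

variable {A : Type*} [Fintype A]

lemma continuous_productProb {n : ℕ} (E : Set (Fin n → A)) :
    Continuous fun μ : A → ℝ => productProb μ E := by
  simp only [productProb_eq_expect]
  unfold expect
  fun_prop

variable [DecidableEq A]

/-- The point of the hyperplane `∑ μ b = 1` with given coordinates away from `a`. -/
noncomputable def ofCorner (a : A) (y : {b // b ≠ a} → ℝ) : A → ℝ :=
  fun b => if h : b = a then 1 - ∑ c, y c else y ⟨b, h⟩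

lemma ofCorner_self (a : A) (y : {b // b ≠ a} → ℝ) : ofCorner a y a = 1 - ∑ c, y c := by
  simp [ofCorner]

lemma ofCorner_of_ne {a b : A} (h : b ≠ a) (y : {b // b ≠ a} → ℝ) :
    ofCorner a y b = y ⟨b, h⟩ := by
  simp [ofCorner, h]

lemma sum_eq_add_sum_ne (a : A) (g : A → ℝ) : ∑ b, g b = g a + ∑ c : {b // b ≠ a}, g c := by
  rw [← Finset.add_sum_erase univ g (mem_univ a)]
  congr 1
  exact Finset.sum_subtype _ (by simp) g

lemma card_ne (a : A) : Fintype.card {b // b ≠ a} = Fintype.card A - 1 := by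
  simp

lemma sum_ofCorner (a : A) (y : {b // b ≠ a} → ℝ) : ∑ b, ofCorner a y b = 1 := by
  rw [sum_eq_add_sum_ne a, ofCorner_self]
  have : ∀ c : {b // b ≠ a}, ofCorner a y c = y c := fun c => ofCorner_of_ne c.2 y
  simp only [this]
  ring

lemma ofCorner_restrict (a : A) {μ : A → ℝ} (hμ : ∑ b, μ b = 1) :
    ofCorner a (fun b => μ b) = μ := by
  funext b
  rw [sum_eq_add_sum_ne a] at hμ
  by_cases h : b = a
  · subst h
    rw [ofCorner_self]
    linarith
  · rw [ofCorner_of_ne h]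

lemma ofCorner_mem_stdSimplex {a : A} {y : {b // b ≠ a} → ℝ} :
    ofCorner a y ∈ stdSimplex ℝ A ↔ (∀ b, 0 ≤ y b) ∧ ∑ b, y b ≤ 1 := by
  constructor
  · intro h
    refine ⟨fun b => ?_, ?_⟩
    · have := h.1 b
      rwa [ofCorner_of_ne b.2] at this
    · have := h.1 a
      rw [ofCorner_self] at this
      linarith
  · rintro ⟨h0, h1⟩
    refine ⟨fun b => ?_, sum_ofCorner a y⟩
    by_cases hb : b = a
    · subst hb
      rw [ofCorner_self]
      linarith
    · rw [ofCorner_of_ne hb]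
      exact h0 _

lemma lipschitzWith_ofCorner (a : A) :
    LipschitzWith (Fintype.card A : NNReal) (ofCorner a) := by
  refine LipschitzWith.of_dist_le_mul fun y z => ?_
  have hc : 1 ≤ Fintype.card A := Fintype.card_pos_iff.2 ⟨a⟩
  have hd : 0 ≤ dist y z := dist_nonneg
  rw [dist_pi_le_iff (by positivity)]
  intro b
  by_cases hb : b = a
  · subst hb
    rw [ofCorner_self, ofCorner_self, Real.dist_eq]
    calc |1 - ∑ c, y c - (1 - ∑ c, z c)| = |∑ c, (z c - y c)| := by
          rw [Finset.sum_sub_distrib]; congr 1; ring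
      _ ≤ ∑ c, |z c - y c| := Finset.abs_sum_le_sum_abs _ _
      _ ≤ ∑ _c : {c // c ≠ b}, dist y z := Finset.sum_le_sum fun c _ => by
          rw [abs_sub_comm, ← Real.dist_eq]
          exact dist_le_pi_dist y z c
      _ = (Fintype.card {c // c ≠ b} : ℝ) * dist y z := by simp
      _ ≤ _ := by
          have : Fintype.card {c // c ≠ b} ≤ Fintype.card A := Fintype.card_subtype_le _
          simp only [NNReal.coe_natCast]
          gcongr
  · rw [ofCorner_of_ne hb, ofCorner_of_ne hb]
    refine (dist_le_pi_dist y z _).trans ?_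
    have : (1 : ℝ) ≤ Fintype.card A := by exact_mod_cast hc
    simp only [NNReal.coe_natCast]
    nlinarith

/-- The corner chart is `|A|`-Lipschitz for the sup norm, and passing to the Euclidean norm costs at
most another `|A|`. Hausdorff measure in dimension `|A| - 1` grows at most by that power of the
constant. -/
lemma hausdorffMeasure_corner_le (a : A) (E : Set (A → ℝ)) (hE : E ⊆ stdSimplex ℝ A) :
    Measure.hausdorffMeasure ((Fintype.card A : ℝ) - 1)
        ((WithLp.ofLp : EuclideanSpace ℝ A → (A → ℝ)) ⁻¹' E) ≤
      (Fintype.card A * Fintype.card A) ^ (Fintype.card A - 1) *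
        volume {y : {b // b ≠ a} → ℝ | ofCorner a y ∈ E} := by
  have hc : 1 ≤ Fintype.card A := Fintype.card_pos_iff.2 ⟨a⟩
  have hd : (Fintype.card A : ℝ) - 1 = (Fintype.card {b // b ≠ a} : ℝ) := by
    rw [card_ne, Nat.cast_sub hc, Nat.cast_one]
  have hLip : LipschitzWith (Fintype.card A * Fintype.card A : NNReal)
      (fun y : {b // b ≠ a} → ℝ => (WithLp.toLp 2 (ofCorner a y) : EuclideanSpace ℝ A)) := by
    refine LipschitzWith.weaken
      ((PiLp.lipschitzWith_toLp 2 (fun _ : A => ℝ)).comp (lipschitzWith_ofCorner a)) ?_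
    gcongr
    have h1 : (1 : NNReal) ≤ Fintype.card A := by exact_mod_cast hc
    refine (NNReal.rpow_le_rpow_of_exponent_le h1 (z := 1) ?_).trans_eq (NNReal.rpow_one _)
    norm_num
  have hsub : (WithLp.ofLp : EuclideanSpace ℝ A → (A → ℝ)) ⁻¹' E ⊆
      (fun y : {b // b ≠ a} → ℝ => (WithLp.toLp 2 (ofCorner a y) : EuclideanSpace ℝ A)) ''
        {y | ofCorner a y ∈ E} := by
    intro x hx
    have h1 := ofCorner_restrict a (hE hx).2
    refine ⟨fun b => x b, ?_, ?_⟩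
    · show ofCorner a (fun b => x b) ∈ E
      rw [h1]; exact hx
    · show WithLp.toLp 2 (ofCorner a (fun b => x b)) = x
      rw [h1]
  refine (measure_mono hsub).trans ?_
  rw [hd]
  refine (hLip.hausdorffMeasure_image_le (Nat.cast_nonneg _) _).trans ?_
  rw [hausdorffMeasure_pi_real, ENNReal.rpow_natCast, card_ne]
  simp

/-- Forgetting coordinate `a` is 1-Lipschitz and maps the simplex onto a set containing a cube of
side `1 / |A|`. -/
lemma le_hausdorffMeasure_stdSimplex (a : A) :
    (((Fintype.card A : ENNReal) ^ (Fintype.card A - 1)))⁻¹ ≤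
      Measure.hausdorffMeasure ((Fintype.card A : ℝ) - 1)
        ((WithLp.ofLp : EuclideanSpace ℝ A → (A → ℝ)) ⁻¹' stdSimplex ℝ A) := by
  have hc : 1 ≤ Fintype.card A := Fintype.card_pos_iff.2 ⟨a⟩
  have hcR : (0 : ℝ) < Fintype.card A := by exact_mod_cast hc
  have hd : (Fintype.card A : ℝ) - 1 = (Fintype.card {b // b ≠ a} : ℝ) := by
    rw [card_ne, Nat.cast_sub hc, Nat.cast_one]
  have hLip : LipschitzWith 1
      (fun (x : EuclideanSpace ℝ A) (b : {b // b ≠ a}) => x b) := by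
    refine LipschitzWith.of_dist_le_mul fun x y => ?_
    rw [NNReal.coe_one, one_mul, dist_pi_le_iff dist_nonneg]
    intro b
    refine (dist_le_pi_dist (WithLp.ofLp x) (WithLp.ofLp y) b).trans ?_
    simpa using (PiLp.lipschitzWith_ofLp 2 (fun _ : A => ℝ)).dist_le_mul x y
  have hsub : Set.Icc (0 : {b // b ≠ a} → ℝ) (fun _ => (Fintype.card A : ℝ)⁻¹) ⊆
      (fun (x : EuclideanSpace ℝ A) (b : {b // b ≠ a}) => x b) ''
        ((WithLp.ofLp : EuclideanSpace ℝ A → (A → ℝ)) ⁻¹' stdSimplex ℝ A) := by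
    intro y hy
    refine ⟨WithLp.toLp 2 (ofCorner a y), ?_, ?_⟩
    · refine ofCorner_mem_stdSimplex.2 ⟨fun b => hy.1 b, ?_⟩
      calc ∑ b, y b ≤ ∑ _b : {b // b ≠ a}, (Fintype.card A : ℝ)⁻¹ :=
            Finset.sum_le_sum fun b _ => hy.2 b
        _ = (Fintype.card {b // b ≠ a} : ℝ) * (Fintype.card A : ℝ)⁻¹ := by simp
        _ ≤ (Fintype.card A : ℝ) * (Fintype.card A : ℝ)⁻¹ := by
            have : Fintype.card {c // c ≠ a} ≤ Fintype.card A := Fintype.card_subtype_le _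
            gcongr
        _ = 1 := mul_inv_cancel₀ hcR.ne'
    · funext b
      exact ofCorner_of_ne b.2 y
  have h1 := (measure_mono hsub).trans
    (b := (Measure.hausdorffMeasure (Fintype.card {b // b ≠ a} : ℝ)) _)
    (hLip.hausdorffMeasure_image_le (Nat.cast_nonneg _) _)
  rw [hd]
  rw [hausdorffMeasure_pi_real, Real.volume_Icc_pi] at h1
  simp only [ENNReal.coe_one, ENNReal.one_rpow, one_mul] at h1
  refine le_trans (le_of_eq ?_) h1
  simp [ENNReal.ofReal_inv_of_pos hcR, ENNReal.inv_pow]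

/-- The uniform measure on the simplex is controlled by Lebesgue measure in the corner
coordinates at the vertex `a`. -/
lemma simplexMeasure_le_volume (a : A) {E : Set (A → ℝ)} (hE : E ⊆ stdSimplex ℝ A)
    (hEm : MeasurableSet E) :
    simplexMeasure A E ≤ ((Fintype.card A : ENNReal) ^ 3) ^ (Fintype.card A - 1) *
        volume {y : {b // b ≠ a} → ℝ | ofCorner a y ∈ E} := by
  have hΔ : MeasurableSet (stdSimplex ℝ A) := (isClosed_stdSimplex ℝ A).measurableSet
  have hm : Measurable (WithLp.ofLp : EuclideanSpace ℝ A → (A → ℝ)) :=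
    (PiLp.continuous_ofLp 2 _).measurable
  rw [simplexMeasure, cond_apply hΔ, Set.inter_eq_self_of_subset_right hE,
    Measure.map_apply hm hΔ, Measure.map_apply hm hEm]
  have h1 := ENNReal.inv_le_inv.2 (le_hausdorffMeasure_stdSimplex a)
  rw [inv_inv] at h1
  refine (mul_le_mul' h1 (hausdorffMeasure_corner_le a E hE)).trans_eq ?_
  rw [← mul_assoc, ← mul_pow]
  congr 2
  ring

lemma continuous_ofCorner (a : A) : Continuous (ofCorner a) := (lipschitzWith_ofCorner a).continuous

/-- Rays from the origin in corner coordinates are the segments issuing from `δ_a`; `ν` is `y`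
normalised. -/
lemma ofCorner_smul_eq_mix (a : A) (y : {b // b ≠ a} → ℝ) (hy : ∑ b, y b ≠ 0) (r : ℝ) :
    ofCorner a (r • y) =
      mix (fun b => if h : b = a then 0 else y ⟨b, h⟩ / ∑ c, y c) a (1 - r * ∑ c, y c) := by
  funext b
  unfold mix
  by_cases hb : b = a
  · subst hb
    rw [ofCorner_self]
    simp [Finset.mul_sum]
  · rw [ofCorner_of_ne hb]
    simp [hb]
    field_simp

end Simplex

/-! ### Assembling the bound. -/

section Main

variable {A : Type*} [Fintype A] [DecidableEq A] {n : ℕ}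

lemma ray_window {f : (Fin n → A) → A} (hn : 0 < n) (hsymm : IsSymmetric f)
    (hmon : IsMonotone f) {a : A} {ε : ℝ} (hε : 0 < ε) {y : {b // b ≠ a} → ℝ}
    (hy : ∀ b, 0 ≤ y b) (hs : 0 < ∑ b, y b) {κ : ℝ} (hκ : 0 ≤ κ)
    (hκy : ∀ b, κ * ∑ c, y c ≤ y b) {r r' : ℝ} (hr : 0 < r) (hrr : r ≤ r')
    (hr1 : r' * ∑ b, y b ≤ 1)
    (hεr : productProb (ofCorner a (r • y)) {x | f x = a} ≤ 1 - ε)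
    (hεr' : ε ≤ productProb (ofCorner a (r' • y)) {x | f x = a}) :
    max 1 (κ * Real.log n / 16) * ((r' - r) * ∑ b, y b) ≤
      2 * (Real.log (1 - ε) - Real.log ε) := by
  rw [ofCorner_smul_eq_mix a y hs.ne'] at hεr hεr'
  have hν : ∑ b, (if h : b = a then 0 else y ⟨b, h⟩ / ∑ c, y c) = 1 := by
    rw [sum_eq_add_sum_ne a]
    have : ∀ c : {b // b ≠ a}, (if h : (c : A) = a then 0 else y ⟨c, h⟩ / ∑ c, y c) =
        y c / ∑ c, y c := fun c => by rw [dif_neg c.2]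
    simp only [this, ← Finset.sum_div, dite_true, zero_add]
    exact div_self hs.ne'
  -- The parameter `t = 1 - r ∑ y` reverses orientation, so the larger radius `r'` gives the left
  -- endpoint.
  have key := window_le hn hsymm hmon (ν := fun b => if h : b = a then 0 else y ⟨b, h⟩ / ∑ c, y c)
    (a := a) (κ := κ) (s := 1 - r' * ∑ b, y b) (t := 1 - r * ∑ b, y b) (ε := ε)
    (fun b => by
      by_cases h : b = a
      · simp [h]
      · simp only [h, dite_false]
        exact div_nonneg (hy _) hs.le)
    hν (by simp) hκ
    (fun b h => by
      simp only [h, dite_false]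
      rw [le_div_iff₀ hs]
      exact hκy _)
    hε (by linarith) (by nlinarith) (by nlinarith) hεr' hεr
  refine le_trans (le_of_eq ?_) key
  ring

lemma one_lt_log_natCast {n : ℕ} (hn : 3 ≤ n) : 1 < Real.log n := by
  have h3 : (3 : ℝ) ≤ n := by exact_mod_cast hn
  rw [Real.lt_log_iff_exp_lt (by linarith)]
  linarith [Real.exp_one_lt_d9]

end Main

end SharpThreshold

open SharpThreshold in
theorem theorem1 (q : ℕ) :
    ∃ C : ℝ, 0 < C ∧
      ∀ (A : Type*) [Fintype A], Fintype.card A = q →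
      ∀ (n : ℕ), 3 ≤ n →
      ∀ f : (Fin n → A) → A,
        SharpThreshold.IsSymmetric f → SharpThreshold.IsMonotone f →
      ∀ (a : A) (ε : ℝ), 0 < ε → ε ≤ 1 / 2 →
        SharpThreshold.simplexMeasure A
            {μ : A → ℝ | μ ∈ stdSimplex ℝ A ∧
              ε ≤ SharpThreshold.productProb μ {x | f x = a} ∧
              SharpThreshold.productProb μ {x | f x = a} ≤ 1 - ε} ≤
          ENNReal.ofReal
            (C * (Real.log (1 - ε) - Real.log ε) *
              (Real.log (Real.log n) / Real.log n)) := by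
  have hc0 : 0 < Real.log (Real.log 3) := by
    have := one_lt_log_natCast (le_refl 3)
    exact Real.log_pos (by exact_mod_cast this)
  -- The power of `q ^ 3` compares `γ` with Lebesgue measure; `2 ^ (q - 1)`, `q - 1` and `16 (q -
  -- 1)` come from the ray integration. The `4` is `2` from the window bound times `2` from `∑ y >
  -- 1/2`. The term `1 / log log 3` absorbs `1 / log n` into `log log n / log n`, and `+ 1` keeps
  -- the constant positive when `q ≤ 1`.
  refine ⟨((q : ℝ) ^ 3) ^ (q - 1) * 2 ^ (q - 1) * ((q - 1 : ℕ) : ℝ) * 4 *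
    (1 / Real.log (Real.log 3) + 16 * ((q - 1 : ℕ) : ℝ)) + 1, by positivity, ?_⟩
  intro A _ hA n hn f hsymm hmon a ε hε hε2
  classical
  subst hA
  have hℓ := one_lt_log_natCast hn
  have hL : 0 ≤ Real.log (1 - ε) - Real.log ε :=
    sub_nonneg.2 (Real.log_le_log hε (by linarith))
  set E : Set (A → ℝ) := {μ | μ ∈ stdSimplex ℝ A ∧
    ε ≤ productProb μ {x | f x = a} ∧ productProb μ {x | f x = a} ≤ 1 - ε} with hE
  -- With a single letter the event `f = a` is certain, and `1 ≤ 1 - ε` fails.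
  rcases isEmpty_or_nonempty {b // b ≠ a} with hB | hB
  · have hall : ∀ b, b = a := fun b => by
      by_contra h
      exact hB.false ⟨b, h⟩
    have : E = ∅ := by
      refine Set.eq_empty_of_forall_notMem fun μ hμ => ?_
      have h1 : productProb μ {x | f x = a} = 1 := by
        have : ({x | f x = a} : Set (Fin n → A)).indicator (fun _ => (1 : ℝ)) = fun _ => 1 := by
          funext x; simp [hall (f x)]
        rw [productProb_eq_expect, this, expect_const hμ.1.2]
      have := hμ.2.2
      rw [h1] at this
      linarith
    rw [this, measure_empty]
    exact zero_le
  have hclosed : IsClosed E :=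
    (isClosed_stdSimplex ℝ A).inter
      ((isClosed_le continuous_const (continuous_productProb _)).inter
        (isClosed_le (continuous_productProb _) continuous_const))
  refine (simplexMeasure_le_volume a (fun μ hμ => hμ.1) hclosed.measurableSet).trans ?_
  have hvol := volume_le_of_ray_windows (E := {y : {b // b ≠ a} → ℝ | ofCorner a y ∈ E})
    (hclosed.preimage (continuous_ofCorner a)).measurableSet
    (fun y hy => (ofCorner_mem_stdSimplex.1 hy.1).1)
    (fun y hy => (ofCorner_mem_stdSimplex.1 hy.1).2) hℓ (mul_nonneg zero_le_two hL)
    (fun y hy hs κ hκ hκy r r' hr hrr hrE hrE' => by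
      refine ray_window (by omega) hsymm hmon hε hy hs hκ hκy hr hrr ?_ hrE.2.2 hrE'.2.1
      have := (ofCorner_mem_stdSimplex.1 hrE'.1).2
      simpa [Finset.mul_sum] using this)
  refine (mul_le_mul_right hvol _).trans ?_
  rw [card_ne]
  set q := Fintype.card A
  set m := q - 1
  set L := Real.log (1 - ε) - Real.log ε
  set ℓ := Real.log n
  have hℓ0 : 0 < ℓ := by linarith
  have hll : Real.log (Real.log 3) ≤ Real.log ℓ := by
    have h3 : (3 : ℝ) ≤ n := by exact_mod_cast hn
    have h1 : 1 < Real.log 3 := by exact_mod_cast one_lt_log_natCast (le_refl 3)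
    exact Real.log_le_log (by linarith) (Real.log_le_log (by norm_num) h3)
  have hll0 : 0 < Real.log ℓ := hc0.trans_le hll
  have e : ((q : ENNReal) ^ 3) ^ m * (2 ^ m * (m * ENNReal.ofReal
      (2 * (2 * L) * (1 / ℓ + 16 * m * Real.log ℓ / ℓ)))) =
      ENNReal.ofReal (((q : ℝ) ^ 3) ^ m * (2 ^ m * (m *
        (2 * (2 * L) * (1 / ℓ + 16 * m * Real.log ℓ / ℓ))))) := by
    generalize 2 * (2 * L) * (1 / ℓ + 16 * m * Real.log ℓ / ℓ) = X
    rw [ENNReal.ofReal_mul (by positivity), ENNReal.ofReal_mul (by positivity),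
      ENNReal.ofReal_mul (p := (m : ℝ)) (by positivity), ENNReal.ofReal_pow (by positivity),
      ENNReal.ofReal_pow (by positivity), ENNReal.ofReal_pow (by positivity)]
    simp
  rw [e]
  refine ENNReal.ofReal_le_ofReal ?_
  have h1 : 1 / ℓ + 16 * m * Real.log ℓ / ℓ ≤
      (1 / Real.log (Real.log 3) + 16 * m) * (Real.log ℓ / ℓ) := by
    have : 1 / ℓ ≤ 1 / Real.log (Real.log 3) * (Real.log ℓ / ℓ) := by
      rw [div_mul_div_comm, one_mul, div_le_div_iff₀ hℓ0 (by positivity), one_mul]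
      gcongr
    rw [add_mul, mul_div_assoc]
    gcongr
  calc _ ≤ ((q : ℝ) ^ 3) ^ m * (2 ^ m * (m *
        (2 * (2 * L) * ((1 / Real.log (Real.log 3) + 16 * m) * (Real.log ℓ / ℓ))))) := by
        gcongr
    _ = ((q : ℝ) ^ 3) ^ m * 2 ^ m * m * 4 * (1 / Real.log (Real.log 3) + 16 * m) * L *
        (Real.log ℓ / ℓ) := by ring
    _ ≤ _ := by
        gcongr
        linarith
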